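/- **Setting.** A master uses $n\ge 1$ workers over an infinite sequence of rounds. The data $X_1,\dots,X_k$ ($k\ge1$) lie in a finite-dimensional vector space $V$ over a field $\mathbb F$. In each round the evaluations $f(X_1),\dots,f(X_k)$ are requested, where $f$ is an arbitrary multivariate polynomial on $V$ of degree $D=\deg f\ge 1$ with coefficients in a nonzero $\mathbb F$-vector space $W$; we assume $D\le\dim V$. A *linear coding scheme* is a matrix $\vec g\in\mathbb F^{nr\times k}$; it gives $nr$ encoded chunks $\tilde X_v=\sum_j g_{v,j}X_j$, of which each worker stores $r$. Its *recovery threshold* $K(\vec g)$ is the least $\kappa$ such that for every set of $\kappa$ chunks and every polynomial $f:V\to W$ of degree $D$ the values $f(X_1),\dots,f(X_k)$ are a function of the $\kappa$ results $f(\tilde X_v)$ (a condition that is void for $\kappa=nr+1$). Worker $i$ is in round $m$ in a good or a bad state $S_i[m]$ and then computes at speed $\mu_g$ or $\mu_b$ (evaluations per unit of time), $0<\mu_b<\mu_g$. The chains $S_1,\dots,S_n$ are mutually independent stationary two-state Markov chains with transition probabilities $p_{g\to g,i},p_{b\to b,i}\in(0,1)$. If worker $i$ is assigned the load $\ell_{m,i}\in\{0,\dots,r\}$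 in round $m$, it returns all its $\ell_{m,i}$ results at time $\ell_{m,i}$ divided by its speed. A *computation strategy* $\eta=(\vec g,\{\vec\ell_m\})$ consists of a linear coding scheme and load vectors $\vec\ell_m$ which may depend on the states of all workers in the rounds before $m$ and on a randomization variable independent of all states (and which may be tailored to the transition probabilities). Given a deadline $d>0$, put $N_m(d)=1$ if at least $K(\vec g)$ results arrive by time $d$ in round $m$, and $N_m(d)=0$ otherwise. If $\frac1M\sum_{m=1}^M N_m(d)$ converges almost surely to a constant, this constant is the *timely computation throughput* $R(d,\eta)$. Let $R^*(d)=\sup_\eta R(d,\eta)$ over all strategies that have a throughput. **LEA.** Put $\ell_b=\lfloor\mu_bd\rfloor$, $\ell_g=\min(\lfloor\mu_gd\rfloor,r)$, and $K^*=(k-1)D+1$ if $nr\ge kD-1$, $K^*=nr-\lfloor nr/k\rfloor+1$ otherwise. Assume $n\ell_b<K^*$ (otherwise assigning $\ell_b$ to every worker always provides $K^*$ results in time). A Lagrange Estimate-and-Allocate (LEA) strategy encodes as follows. If $nr\ge kD-1$, then $g_{v,j}=\prod_{l\ne j}\frac{\alpha_v-\beta_l}{\beta_j-\beta_l}$ for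 distinct $\alpha_1,\dots,\alpha_{nr}\in\mathbb F$ and distinct $\beta_1,\dots,\beta_k\in\mathbb F$. Otherwise every $X_j$ is replicated $\lfloor nr/k\rfloor$ or $\lceil nr/k\rceil$ times. In round $m$ it uses estimates $\hat p_{g,i}(m)$ of the probability that worker $i$ is good, computed from the numbers $C_{x\to y,i}$ of transitions $x\to y$ of worker $i$ in the earlier rounds: $\hat p_{g,i}(m)=\frac{C_{g\to g,i}}{C_{g\to g,i}+C_{g\to b,i}}$ if worker $i$ was good in round $m-1$, and $\hat p_{g,i}(m)=1-\frac{C_{b\to b,i}}{C_{b\to g,i}+C_{b\to b,i}}$ if it was bad (any number in $[0,1]$ while this is undefined). The workers are ordered so that $\hat p_{g,i}(m)$ is non-increasing, and $i^*_m\in\{1,\dots,n\}$ is chosen to maximize the estimated success probability $$\hat{\mathbb P}_m(\tilde i)=\sum_{l=w(\tilde i)}^{\tilde i}\ \sum_{\mathcal G\subseteq[\tilde i],\,|\mathcal G|=l}\ \prod_{i\in\mathcal G}\hat p_{g,i}(m)\prod_{i\in[\tilde i]\setminus\mathcal G}(1-\hat p_{g,i}(m)),\qquad w(\tilde i)=\Big\lceil\tfrac{K^*-(n-\tilde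 i)\ell_b}{\ell_g}\Big\rceil,$$ with $\hat{\mathbb P}_m(\tilde i)=0$ if $K^*>\tilde i\ell_g+(n-\tilde i)\ell_b$. The first $i^*_m$ workers get load $\ell_g$, the others $\ell_b$; ties in the ordering and in the maximization are broken arbitrarily. **Theorem.** LEA is optimal: for every LEA strategy, $\frac1M\sum_{m=1}^M N_m(d)$ converges as $M\to\infty$, and $$R_{\mathrm{LEA}}(d)=R^*(d)\quad\text{almost surely},$$ although LEA uses neither the transition probabilities nor the current states. Moreover, for every computation strategy $\eta$ (whether or not it has a throughput), $\limsup_{M\to\infty}\frac1M\sum_{m=1}^M N_m(d)\le R^*(d)$ almost surely. -/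

import Mathlib

open MeasureTheory ProbabilityTheory Filter Topology

noncomputable section

namespace CodedComputing

/-! ### Coding -/

/-- `f : V → W` is (the function of) a multivariate polynomial, in the coordinates of the
finite-dimensional space `V`, with vector coefficients in `W` and total degree exactly `D`. -/
def IsPolynomialOfDegree (F : Type*) {V W : Type*} [Field F] [AddCommGroup V] [Module F V]
    [FiniteDimensional F V] [AddCommGroup W] [Module F W] (D : ℕ) (f : V → W) : Prop :=
  ∃ p : (Fin (Module.finrank F V) →₀ ℕ) →₀ W,
    p.support.sup Finsupp.degree = D ∧
    ∀ x : V, f x =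
      p.sum fun e w => (e.prod fun i a => ((Module.finBasis F V).repr x i) ^ a) • w

/-- The encoded chunks `X̃_v = ∑_j G v j • X_j` of a linear coding scheme `G`.
The chunk `v = (i, c)` is the `c`-th chunk stored at worker `i`. -/
def encode {F V : Type*} [Field F] [AddCommGroup V] [Module F V] {n r k : ℕ}
    (G : Matrix (Fin n × Fin r) (Fin k) F) (X : Fin k → V) (v : Fin n × Fin r) : V :=
  ∑ j, G v j • X j

/-- The results of the evaluations over the chunks in `S` allow the master to recover
`f(X_1), …, f(X_k)`, for every request `f` of degree `D` and every dataset; the decoding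
function may depend on the (known) request `f` and is otherwise arbitrary. -/
def CanRecover {F : Type*} (V W : Type*) [Field F] [AddCommGroup V] [Module F V]
    [FiniteDimensional F V] [AddCommGroup W] [Module F W] {n r k : ℕ} (D : ℕ)
    (G : Matrix (Fin n × Fin r) (Fin k) F) (S : Finset (Fin n × Fin r)) : Prop :=
  ∀ f : V → W, IsPolynomialOfDegree F D f →
    ∃ dec : (S → W) → (Fin k → W), ∀ X : Fin k → V,
      dec (fun v => f (encode G X v)) = fun j => f (X j)

/-- The recovery threshold `K(G)`: the least `κ` such that any `κ` of the `nr` results suffice. -/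
def recoveryThreshold {F : Type*} (V W : Type*) [Field F] [AddCommGroup V] [Module F V]
    [FiniteDimensional F V] [AddCommGroup W] [Module F W] {n r k : ℕ} (D : ℕ)
    (G : Matrix (Fin n × Fin r) (Fin k) F) : ℕ :=
  sInf {κ : ℕ | ∀ S : Finset (Fin n × Fin r), S.card = κ → CanRecover V W D G S}

/-- `G` is a Lagrange coding scheme for `k` inputs and degree `D`: evaluation of the Lagrange
interpolation polynomial through `(β_j, X_j)` at distinct points `α_v` if `nr ≥ kD - 1`, and
repetition of each input `⌊nr/k⌋` or `⌈nr/k⌉` times otherwise. -/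
def IsLagrangeCode {F : Type*} [Field F] {n r k : ℕ} (D : ℕ)
    (G : Matrix (Fin n × Fin r) (Fin k) F) : Prop :=
  (k * D ≤ n * r + 1 ∧
    ∃ (α : Fin n × Fin r → F) (β : Fin k → F), Function.Injective α ∧ Function.Injective β ∧
      ∀ v j, G v j = ∏ l ∈ Finset.univ.erase j, (α v - β l) / (β j - β l)) ∨
  (n * r + 1 < k * D ∧
    ∃ a : Fin n × Fin r → Fin k,
      (∀ j, (Finset.univ.filter fun v => a v = j).card = n * r / k ∨
        (Finset.univ.filter fun v => a v = j).card = (n * r) ⌈/⌉ k) ∧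
      ∀ v j, G v j = if a v = j then 1 else 0)

/-! ### Workers and their states -/

/-- The known parameters: `n` workers storing `r` chunks each, `k` data blocks, requests of degree
`deg`, computing speeds `muG`, `muB` in the good and the bad state, and the deadline `d`. -/
structure CloudSystem where
  n : ℕ
  r : ℕ
  k : ℕ
  deg : ℕ
  muG : ℝ
  muB : ℝ
  d : ℝ
  n_pos : 0 < n
  k_pos : 0 < k
  deg_pos : 0 < deg
  muB_pos : 0 < muB
  muB_lt_muG : muB < muG
  d_pos : 0 < d

/-- Transition probabilities of a two-state chain; `true` is the good state. -/
def trans (pGG pBB : ℝ) : Bool → Bool → ℝ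
  | true, true => pGG
  | true, false => 1 - pGG
  | false, false => pBB
  | false, true => 1 - pBB

/-- The stationary distribution of the two-state chain. -/
def stationary (pGG pBB : ℝ) : Bool → ℝ
  | true => (1 - pBB) / ((1 - pGG) + (1 - pBB))
  | false => (1 - pGG) / ((1 - pGG) + (1 - pBB))

/-- `S` is a stationary two-state Markov chain with the given transition probabilities, described
by its finite-dimensional distributions. -/
def IsStationaryChain {Ω : Type*} [MeasurableSpace Ω] (μ : Measure Ω) (pGG pBB : ℝ)
    (S : ℕ → Ω → Bool) : Prop :=
  (∀ m, Measurable (S m)) ∧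
  ∀ (m : ℕ) (s : ℕ → Bool),
    μ.real {ω | ∀ t ≤ m, S t ω = s t} =
      stationary pGG pBB (s 0) * ∏ t ∈ Finset.range m, trans pGG pBB (s t) (s (t + 1))

namespace CloudSystem

variable (C : CloudSystem)

/-- Computing speed in a given state. -/
def speed (good : Bool) : ℝ := if good then C.muG else C.muB

/-- `ℓ_b = μ_b d` (rounded down if this is not an integer). -/
def loadB : ℕ := ⌊C.muB * C.d⌋₊

/-- `ℓ_g = min (μ_g d, r)` (rounded down if this is not an integer). -/
def loadG : ℕ := min ⌊C.muG * C.d⌋₊ C.r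

/-- The threshold `K*` used by LEA. -/
def kStar : ℕ :=
  if C.k * C.deg ≤ C.n * C.r + 1 then (C.k - 1) * C.deg + 1
  else C.n * C.r - C.n * C.r / C.k + 1

/-- The states of all workers in rounds `0, …, m - 1`. -/
abbrev History (m : ℕ) : Type := Fin m → Fin C.n → Bool

/-- Number of results received by the deadline in one round, with load allocation `ℓ` and states
`s`: worker `i` returns all its `ℓ i` results at time `ℓ i / speed`. -/
def received (ℓ : Fin C.n → ℕ) (s : Fin C.n → Bool) : ℕ :=
  ∑ i, if (ℓ i : ℝ) / C.speed (s i) ≤ C.d then ℓ i else 0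

end CloudSystem

/-! ### Strategies and throughput -/

/-- A computation strategy: a linear coding scheme, fixed beforehand, and load allocation vectors.
The loads in round `m` may depend on the states of all workers in the earlier rounds and on
the value `z` of a randomization variable. -/
structure Strategy (C : CloudSystem) (F 𝒵 : Type*) [MeasurableSpace 𝒵] where
  code : Matrix (Fin C.n × Fin C.r) (Fin C.k) F
  load : (m : ℕ) → 𝒵 → C.History m → Fin C.n → ℕ
  load_le : ∀ m z h i, load m z h i ≤ C.r
  measurable_load : ∀ m h, Measurable fun z => load m z h

section Throughput

variable {C : CloudSystem} {F 𝒵 Ω : Type*} [Field F] [MeasurableSpace 𝒵] [MeasurableSpace Ω]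
  (V W : Type*) [AddCommGroup V] [Module F V] [FiniteDimensional F V]
  [AddCommGroup W] [Module F W]

/-- `N_m(d)`: whether the computation of round `m` is finished by the deadline, that is, whether
the number of results received by then reaches the recovery threshold of the code. -/
def Strategy.success (η : Strategy C F 𝒵) (Z : Ω → 𝒵) (S : Fin C.n → ℕ → Ω → Bool)
    (m : ℕ) (ω : Ω) : ℝ :=
  if recoveryThreshold V W C.deg η.code ≤
      C.received (η.load m (Z ω) fun t i => S i t ω) (fun i => S i m ω)
  then 1 else 0

/-- The fraction of the first `M` rounds that were finished by the deadline. -/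
def Strategy.average (η : Strategy C F 𝒵) (Z : Ω → 𝒵) (S : Fin C.n → ℕ → Ω → Bool)
    (M : ℕ) (ω : Ω) : ℝ :=
  (∑ m ∈ Finset.range M, η.success V W Z S m ω) / M

/-- The timely computation throughput `R(d, η)` exists and equals `ρ`, almost surely. -/
def Strategy.HasThroughput (η : Strategy C F 𝒵) (μ : Measure Ω) (Z : Ω → 𝒵)
    (S : Fin C.n → ℕ → Ω → Bool) (ρ : ℝ) : Prop :=
  ∀ᵐ ω ∂μ, Tendsto (fun M => η.average V W Z S M ω) atTop (𝓝 ρ)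

/-- The optimal timely computation throughput `R*(d)`: the supremum of the throughputs of all
strategies with linear codes over `F`. -/
def optThroughput (C : CloudSystem) (F : Type*) [Field F] (V W : Type*)
    [AddCommGroup V] [Module F V] [FiniteDimensional F V] [AddCommGroup W] [Module F W]
    (μ : Measure Ω) (Z : Ω → 𝒵) (S : Fin C.n → ℕ → Ω → Bool) : ℝ :=
  sSup {ρ : ℝ | ∃ η : Strategy C F 𝒵, η.HasThroughput V W μ Z S ρ}

end Throughput

/-! ### The Lagrange Estimate-and-Allocate strategy -/

section LEA

variable {C : CloudSystem}

/-- Number of transitions of worker `i` from state `a` to state `b` in the history. -/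
def transCount {m : ℕ} (h : C.History m) (i : Fin C.n) (a b : Bool) : ℕ :=
  (Finset.univ.filter fun t : Fin m × Fin m =>
    t.1.val + 1 = t.2.val ∧ h t.1 i = a ∧ h t.2 i = b).card

/-- `p` is the estimate, after the history `h`, of the probability that worker `i` is in
the good state in the next round. The ratio of counts is used whenever it is defined; in the
remaining (initial) rounds the estimate may be any number in `[0, 1]`. -/
def IsEstimate {m : ℕ} (h : C.History m) (i : Fin C.n) (p : ℝ) : Prop :=
  0 ≤ p ∧ p ≤ 1 ∧
  ∀ last : Fin m, last.val + 1 = m →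
    (h last i = true → 0 < transCount h i true true + transCount h i true false →
      p = (transCount h i true true : ℝ) /
        (transCount h i true true + transCount h i true false)) ∧
    (h last i = false → 0 < transCount h i false true + transCount h i false false →
      p = 1 - (transCount h i false false : ℝ) /
        (transCount h i false true + transCount h i false false))

/-- The success probability of assigning `ℓ_g` to the workers in `A` and `ℓ_b` to the others,
computed with (estimated) probabilities `p i` of being in the good state. -/
def estSuccess (p : Fin C.n → ℝ) (A : Finset (Fin C.n)) : ℝ :=
  if A.card * C.loadG + (C.n - A.card) * C.loadB < C.kStar then 0
  else
    ∑ l ∈ Finset.Icc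
        ⌈((C.kStar : ℝ) - ((C.n : ℝ) - A.card) * C.loadB) / C.loadG⌉₊ A.card,
      ∑ B ∈ A.powersetCard l, (∏ i ∈ B, p i) * ∏ i ∈ A \ B, (1 - p i)

/-- The first `a` workers in the order `σ`. -/
def firstWorkers (σ : Equiv.Perm (Fin C.n)) (a : ℕ) : Finset (Fin C.n) :=
  (Finset.univ.filter fun j : Fin C.n => j.val < a).image σ

/-- `ℓ` is a load allocation of the Estimate-and-Allocate algorithm after history `h`: order the
workers by decreasing estimates, let `1 ≤ a ≤ n` maximize the estimated success probability, and
assign `ℓ_g` to the first `a` workers and `ℓ_b` to the others. Ties are broken arbitrarily. -/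
def IsEALoad {m : ℕ} (h : C.History m) (ℓ : Fin C.n → ℕ) : Prop :=
  ∃ (p : Fin C.n → ℝ) (σ : Equiv.Perm (Fin C.n)) (a : ℕ),
    (∀ i, IsEstimate h i (p i)) ∧ Antitone (p ∘ σ) ∧ a ∈ Finset.Icc 1 C.n ∧
    (∀ b ∈ Finset.Icc 1 C.n,
      estSuccess p (firstWorkers σ b) ≤ estSuccess p (firstWorkers σ a)) ∧
    ∀ i, ℓ i = if i ∈ firstWorkers σ a then C.loadG else C.loadB

/-- `η` is a Lagrange Estimate-and-Allocate (LEA) strategy. -/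
def Strategy.IsLEA {F 𝒵 : Type*} [Field F] [MeasurableSpace 𝒵] (η : Strategy C F 𝒵) : Prop :=
  IsLagrangeCode C.deg η.code ∧ ∀ m z (h : C.History m), IsEALoad h (η.load m z h)

end LEA

end CodedComputing

end

namespace CodedComputing

/-! ### The optimal recovery threshold of a linear code -/

/-! ### Converse: no linear code has a threshold below `K*`. -/

section Converse

/-! The code and the loads are optimized separately, and both optima are expressed by one constant
`c`, the long-run average of the best conditional success probability.

Code. Take as request a product of `D` distinct coordinates times a nonzero vector. On a suitable
dataset its value at chunk `v` is a product of `D` linear functionals of the coding vector `g_v`. If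
the kernels of these functionals cover all `g_v` with `v ∈ S`, while none of them vanishes at some
unit vector `e_j`, then `S` cannot tell this dataset from the zero dataset, although `f(X_j)`
differs. Splitting bases off the coding vectors and losing one vector per basis yields such an `S`
with at least `K* - 1` elements (`exists_large_annihilated`). Lagrange codes attain `K*`: along the
interpolation curve, monomials of degree at most `D` become univariate polynomials of degree at most
`(k-1)D`. For repetition codes this is a counting argument.

Loads. Given the past, the workers are independently good with probabilities that depend only on
their last states. Loads other than `ℓ_g` and `ℓ_b` are never better (`exists_received_le`), so no
strategy has a conditional success probability above `bestProb`. For any vector of probabilities, an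
exchange argument (`tailProb_image_le`) shows that the sorted assignments considered by LEA include
an optimal one.

Long run. Successes minus their conditional probabilities are bounded and pairwise orthogonal, so
their averages vanish almost surely, however the loads depend on the past
(`ae_tendsto_average_sub_average`). The averages of `bestProb` along the chain converge to `c` by
the Poisson equation, hence every limsup is at most `c`. The estimates of LEA are consistent and
success probabilities are continuous in them, so LEA attains `c`. -/

/-- From a spanning family one can split off a basis, indexed by a finset; all but one of its
members are annihilated by a functional that does not vanish at a prescribed vector. -/
lemma exists_basis_finset {ι F : Type*} [Field F] {k : ℕ} (g : ι → Fin k → F) (R : Finset ι)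
    (hR : Submodule.span F (g '' R) = ⊤) :
    ∃ B ⊆ R, B.card = k ∧ ∀ x : Fin k → F, x ≠ 0 →
      ∃ b ∈ B, ∃ L : Module.Dual F (Fin k → F), L x ≠ 0 ∧ ∀ v ∈ B, v ≠ b → L (g v) = 0 := by
  classical
  obtain ⟨b, hbR, -, hspan, hli⟩ :=
    exists_linearIndepOn_extension (K := F) (v := g) (s := ∅) (t := (R : Set ι))
      (linearIndepOn_empty F g) (Set.empty_subset _)
  have hfin : b.Finite := R.finite_toSet.subset hbR
  have : Fintype b := hfin.fintype
  have htop : ⊤ ≤ Submodule.span F (Set.range fun v : b => g v) := by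
    rw [← hR, Submodule.span_le]
    refine hspan.trans ?_
    rw [Set.image_eq_range]
  let e := Module.Basis.mk hli htop
  refine ⟨b.toFinset, fun v hv => hbR (by simpa using hv), ?_, fun x hx => ?_⟩
  · rw [Set.toFinset_card]
    have := Module.finrank_eq_card_basis e
    simpa using this.symm
  · have : ∃ i, e.coord i x ≠ 0 := by
      by_contra! h
      exact hx (e.forall_coord_eq_zero_iff.1 h)
    obtain ⟨i, hi⟩ := this
    refine ⟨i, by simp, e.coord i, hi, fun v hv hne => ?_⟩
    have hv' : v ∈ b := by simpa using hv
    have h1 : g v = e ⟨v, hv'⟩ := (Module.Basis.mk_apply hli htop ⟨v, hv'⟩).symm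
    rw [h1, Module.Basis.coord_apply, Module.Basis.repr_self, Finsupp.single_apply, if_neg]
    intro h
    exact hne (by rw [← h])

/-- Among finitely many vectors of `F^k` there is a large set that can be covered by the kernels
of `D` functionals, none of which vanishes at a certain unit vector. -/
lemma exists_large_annihilated {ι F : Type*} [Field F] {k : ℕ} (hk : 0 < k)
    (g : ι → Fin k → F) (D : ℕ) (R : Finset ι) :
    ∃ j, ∃ S ⊆ R, ∃ L : Fin D → Module.Dual F (Fin k → F),
      (∀ i, L i (Pi.single j 1) ≠ 0) ∧ (∀ v ∈ S, ∃ i, L i (g v) = 0) ∧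
      ∃ t, k * t ≤ R.card ∧
        (t = D ∧ S.card = (k - 1) * D ∨ t < D ∧ S.card + t = R.card) := by
  classical
  induction D generalizing R with
  | zero =>
    exact ⟨⟨0, hk⟩, ∅, by simp, Fin.elim0, fun i => i.elim0, by simp, 0, by simp, by simp⟩
  | succ D ih =>
    by_cases hR : Submodule.span F (g '' R) = ⊤
    -- The basis `B` is removed before `j` is known: the recursion on `R \ B` fixes `j`, and only
    -- then is the member `b` to be given up chosen, so that the new functional is nonzero at `e_j`.
    -- Thus `t` counts the removed bases, each of which costs one vector.
    · obtain ⟨B, hBR, hB, hx⟩ := exists_basis_finset g R hR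
      obtain ⟨j, S, hS, L, hL, hLS, t, ht, hcard⟩ := ih (R \ B)
      have hcR : (R \ B).card + k = R.card := by
        rw [← hB]; exact Finset.card_sdiff_add_card_eq_card hBR
      obtain ⟨b, hb, L₀, hL₀, hLB⟩ := hx (Pi.single j 1) (by simp)
      have hdisj : Disjoint S (B.erase b) :=
        Finset.disjoint_left.2 fun v hv hvB =>
          (Finset.mem_sdiff.1 (hS hv)).2 (Finset.mem_of_mem_erase hvB)
      have hcS : (S ∪ B.erase b).card = S.card + (k - 1) := by
        rw [Finset.card_union_of_disjoint hdisj, Finset.card_erase_of_mem hb, hB]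
      refine ⟨j, S ∪ B.erase b, ?_, Fin.cons L₀ L, ?_, ?_, t + 1, ?_, ?_⟩
      · exact Finset.union_subset (hS.trans Finset.sdiff_subset)
          ((Finset.erase_subset _ _).trans hBR)
      · intro i
        refine Fin.cases ?_ (fun i => ?_) i
        · simpa using hL₀
        · simpa using hL i
      · intro v hv
        rcases Finset.mem_union.1 hv with hv | hv
        · obtain ⟨i, hi⟩ := hLS v hv
          exact ⟨i.succ, by simpa using hi⟩
        · refine ⟨0, ?_⟩
          have := Finset.mem_erase.1 hv
          simpa using hLB v this.2 this.1
      · rw [mul_add, mul_one]; omega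
      · rw [hcS]
        rcases hcard with ⟨rfl, h⟩ | ⟨h, h'⟩
        · left; refine ⟨rfl, ?_⟩; rw [h, mul_add, mul_one]
        · right; omega
    -- Without a spanning family a single functional annihilates all of `R` but not some `e_j`; it
    -- is used for every index, and nothing is lost.
    · have : ∃ j, (Pi.single j 1 : Fin k → F) ∉ Submodule.span F (g '' R) := by
        by_contra! h
        refine hR (top_le_iff.1 ?_)
        rw [← (Pi.basisFun F (Fin k)).span_eq, Submodule.span_le]
        rintro _ ⟨j, rfl⟩
        simpa using h j
      obtain ⟨j, hj⟩ := this
      obtain ⟨L, hL, hker⟩ := Submodule.exists_le_ker_of_notMem hj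
      refine ⟨j, R, subset_rfl, fun _ => L, fun _ => hL, fun v hv => ⟨0, ?_⟩, 0, by simp, ?_⟩
      · exact hker (Submodule.subset_span ⟨v, hv, rfl⟩)
      · right; simp

variable {F V W : Type*} [Field F] [AddCommGroup V] [Module F V] [FiniteDimensional F V]
  [AddCommGroup W] [Module F W]

/-- A product of distinct coordinates is a polynomial of the expected degree. -/
lemma isPolynomialOfDegree_prod_coord {D : ℕ} (hD : D ≤ Module.finrank F V) {w : W} (hw : w ≠ 0) :
    IsPolynomialOfDegree F D fun x : V =>
      (∏ i : Fin D, (Module.finBasis F V).repr x (Fin.castLE hD i)) • w := by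
  classical
  let e : Fin (Module.finrank F V) →₀ ℕ :=
    ∑ i : Fin D, Finsupp.single (Fin.castLE hD i) 1
  refine ⟨Finsupp.single e w, ?_, fun x => ?_⟩
  · rw [Finsupp.support_single _ hw, Finset.sup_singleton]
    simp [e, map_sum, Finsupp.degree_single]
  · rw [Finsupp.sum_single_index (by simp)]
    have : ∀ s : Finset (Fin D), ((∑ i ∈ s, Finsupp.single (Fin.castLE hD i) 1 :
        Fin (Module.finrank F V) →₀ ℕ).prod fun i a => ((Module.finBasis F V).repr x i) ^ a) =
        ∏ i ∈ s, (Module.finBasis F V).repr x (Fin.castLE hD i) := by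
      intro s
      induction s using Finset.induction_on with
      | empty => simp
      | insert i s hi ih =>
        rw [Finset.sum_insert hi, Finset.prod_insert hi, Finsupp.prod_add_index' (by simp)
          (by intros; rw [pow_add]), ih, Finsupp.prod_single_index (by simp), pow_one]
    exact congrArg (· • w) (this Finset.univ).symm

variable {n r k : ℕ}

/-- The values `L i e_j'` serve as the coordinates of `X_j'`, so the `i`-th coordinate of chunk `v`
is `L i (G v)`. The product of the first `D` coordinates then vanishes on `S` but not at `X_j`,
whereas for the zero dataset it vanishes everywhere. -/
lemma not_canRecover_of_annihilated [Nontrivial W] {D : ℕ} (hpos : 0 < D)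
    (hD : D ≤ Module.finrank F V)
    {G : Matrix (Fin n × Fin r) (Fin k) F} {S : Finset (Fin n × Fin r)} (j : Fin k)
    (L : Fin D → Module.Dual F (Fin k → F)) (hL : ∀ i, L i (Pi.single j 1) ≠ 0)
    (hS : ∀ v ∈ S, ∃ i, L i (G v) = 0) : ¬ CanRecover V W D G S := by
  classical
  intro h
  obtain ⟨w, hw⟩ := exists_ne (0 : W)
  obtain ⟨dec, hdec⟩ := h _ (isPolynomialOfDegree_prod_coord hD hw)
  let b := Module.finBasis F V
  let X : Fin k → V := fun j' => ∑ i : Fin D, L i (Pi.single j' 1) • b (Fin.castLE hD i)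
  have hX : ∀ j' (i : Fin D), b.repr (X j') (Fin.castLE hD i) = L i (Pi.single j' 1) := by
    intro j' i
    simp [X, map_sum, Finsupp.single_apply]
  have hG : ∀ v (i : Fin D), b.repr (encode G X v) (Fin.castLE hD i) = L i (G v) := by
    intro v i
    conv_rhs => rw [← Finset.univ_sum_single (G v), map_sum]
    simp only [encode, map_sum, map_smul, Finsupp.coe_finsetSum, Finset.sum_apply,
      Finsupp.smul_apply, hX, smul_eq_mul]
    refine Finset.sum_congr rfl fun j' _ => ?_
    rw [← smul_eq_mul, ← map_smul, ← Pi.single_smul, smul_eq_mul, mul_one]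
  have h0 := congrFun (hdec fun _ => 0) j
  have h1 := congrFun (hdec X) j
  have : (fun v : S => (∏ i : Fin D, b.repr (encode G X v) (Fin.castLE hD i)) • w) =
      fun v : S => (∏ i : Fin D, b.repr (encode G (fun _ => 0) v) (Fin.castLE hD i)) • w := by
    funext v
    obtain ⟨i, hi⟩ := hS v v.2
    rw [Finset.prod_eq_zero (Finset.mem_univ i) (by rw [hG, hi]),
      Finset.prod_eq_zero (Finset.mem_univ (⟨0, hpos⟩ : Fin D)) (by simp [encode])]
  rw [this] at h1
  rw [h0] at h1
  simp only [map_zero, Finsupp.coe_zero, Pi.zero_apply, Finset.prod_const] at h1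
  rw [Finset.card_univ, Fintype.card_fin, zero_pow hpos.ne', zero_smul] at h1
  have h2 : ∏ i : Fin D, b.repr (X j) (Fin.castLE hD i) ≠ 0 :=
    Finset.prod_ne_zero_iff.2 fun i _ => by rw [hX]; exact hL i
  exact (smul_ne_zero h2 hw) h1.symm

/-- Every linear code has recovery threshold at least `K*`. -/
theorem kStar_le_recoveryThreshold [Nontrivial W] (C : CloudSystem)
    (hD : C.deg ≤ Module.finrank F V) (G : Matrix (Fin C.n × Fin C.r) (Fin C.k) F) :
    C.kStar ≤ recoveryThreshold V W C.deg G := by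
  classical
  obtain ⟨j, S, -, L, hL, hLS, t, ht, hcard⟩ :=
    exists_large_annihilated C.k_pos G C.deg Finset.univ
  have hS : C.kStar ≤ S.card + 1 := by
    simp only [Finset.card_univ, Fintype.card_prod, Fintype.card_fin] at ht hcard
    unfold CloudSystem.kStar
    have h1 : (C.k - 1) * C.deg + C.deg = C.k * C.deg := by
      rw [Nat.sub_mul, one_mul, Nat.sub_add_cancel (Nat.le_mul_of_pos_left _ C.k_pos)]
    -- If `D` bases were split off, then `kD ≤ nr`. Otherwise `|S| = nr - t` with `t ≤ D - 1`, which
    -- is still at least `(k-1)D` as long as `kD ≤ nr + 1`; this is the boundary between the two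
    -- cases of `K*`.
    rcases hcard with ⟨rfl, h⟩ | ⟨h, h'⟩
    · rw [if_pos (by omega), h]
    · split_ifs
      · omega
      · have : t ≤ C.n * C.r / C.k := (Nat.le_div_iff_mul_le C.k_pos).2 (by linarith)
        omega
  -- The defining set contains `nr + 1`, where the condition is void, so the infimum is not the
  -- default value `0` of an empty set.
  refine le_csInf ⟨C.n * C.r + 1, fun T hT => ?_⟩ fun κ hκ => ?_
  · have := T.card_le_univ
    simp only [Fintype.card_prod, Fintype.card_fin] at this
    omega
  · by_contra! hlt
    obtain ⟨T, hTS, hT⟩ := Finset.exists_subset_card_eq (show κ ≤ S.card by omega)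
    exact not_canRecover_of_annihilated C.deg_pos hD j L hL (fun v hv => hLS v (hTS hv))
      (hκ T hT)

end Converse

/-! ### Achievability: Lagrange and repetition codes attain `K*`. -/

section Achievability

open Polynomial

variable {F V W : Type*} [Field F] [AddCommGroup V] [Module F V] [FiniteDimensional F V]
  [AddCommGroup W] [Module F W] {n r k : ℕ}

/-- Linear decoding: recovery is possible once every monomial value at the data points is a fixed
linear combination of the received monomial values. -/
lemma canRecover_of_monomials {D : ℕ} {G : Matrix (Fin n × Fin r) (Fin k) F}
    {S : Finset (Fin n × Fin r)} (c : Fin n × Fin r → Fin k → F)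
    (hc : ∀ e : Fin (Module.finrank F V) →₀ ℕ, e.degree ≤ D → ∀ (X : Fin k → V) (j : Fin k),
      (e.prod fun i a => ((Module.finBasis F V).repr (X j) i) ^ a) =
        ∑ v ∈ S, c v j * e.prod fun i a => ((Module.finBasis F V).repr (encode G X v) i) ^ a) :
    CanRecover V W D G S := by
  rintro f ⟨p, hp, hf⟩
  refine ⟨fun y j => ∑ v : S, c v j • y v, fun X => ?_⟩
  funext j
  change ∑ v : S, c v j • f (encode G X v) = f (X j)
  rw [Finset.sum_coe_sort S fun v => c v j • f (encode G X v), hf (X j)]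
  simp only [hf, Finsupp.sum, Finset.smul_sum]
  rw [Finset.sum_comm]
  refine Finset.sum_congr rfl fun e he => ?_
  rw [hc e (by rw [← hp]; exact Finset.le_sup (f := Finsupp.degree) he) X j, Finset.sum_smul]
  simp only [mul_smul]

/-- The interpolation curve passes through `X_j` at `β_j` and through the encoded chunk `v` at
`α_v`. A monomial of degree at most `D` along this curve has degree at most `(k-1)D`, so its value
at `β_j` is interpolated from its values at the nodes `α_v`, `v ∈ S`. -/
lemma canRecover_lagrange {D : ℕ} {G : Matrix (Fin n × Fin r) (Fin k) F}
    {α : Fin n × Fin r → F} {β : Fin k → F} (hα : Function.Injective α)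
    (hβ : Function.Injective β)
    (hG : ∀ v j, G v j = ∏ l ∈ Finset.univ.erase j, (α v - β l) / (β j - β l))
    {S : Finset (Fin n × Fin r)} (hS : (k - 1) * D < S.card) : CanRecover V W D G S := by
  classical
  refine canRecover_of_monomials (fun v j => (Lagrange.basis S α v).eval (β j)) ?_
  intro e he X j
  let b := Module.finBasis F V
  let u : Fin (Module.finrank F V) → F[X] := fun i =>
    ∑ l, Polynomial.C (b.repr (X l) i) * Lagrange.basis Finset.univ β l
  let Q : F[X] := e.prod fun i a => u i ^ a
  have huα : ∀ v i, (u i).eval (α v) = b.repr (encode G X v) i := by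
    intro v i
    simp only [u, encode, map_sum, map_smul, Finsupp.coe_finsetSum, Finset.sum_apply,
      Finsupp.smul_apply, eval_finsetSum, eval_mul, eval_C, smul_eq_mul]
    refine Finset.sum_congr rfl fun l _ => ?_
    rw [mul_comm, hG, Lagrange.basis, eval_prod]
    congr 1
    refine Finset.prod_congr rfl fun l' _ => ?_
    rw [Lagrange.basisDivisor]
    simp [div_eq_inv_mul]
  have huβ : ∀ i, (u i).eval (β j) = b.repr (X j) i := by
    intro i
    simp only [u, eval_finsetSum, eval_mul, eval_C]
    rw [Finset.sum_eq_single j]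
    · rw [Lagrange.eval_basis_self hβ.injOn (Finset.mem_univ j), mul_one]
    · intro l _ hl
      rw [Lagrange.eval_basis_of_ne hl (Finset.mem_univ j), mul_zero]
    · simp
  have hQ : ∀ x, Q.eval x = e.prod fun i a => ((u i).eval x) ^ a := by
    intro x
    simp only [Q, Finsupp.prod, eval_prod, eval_pow]
  have hu : ∀ i, (u i).natDegree ≤ k - 1 := by
    intro i
    refine natDegree_sum_le_of_forall_le _ _ fun l _ => ?_
    refine (natDegree_C_mul_le _ _).trans ?_
    have := Lagrange.degree_basis (s := Finset.univ) hβ.injOn (Finset.mem_univ l)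
    rw [natDegree_eq_of_degree_eq_some this]
    simp
  have hdeg : Q.degree < S.card := by
    refine degree_le_natDegree.trans_lt (Nat.cast_lt.2 (lt_of_le_of_lt ?_ hS))
    calc Q.natDegree ≤ ∑ i ∈ e.support, (u i ^ e i).natDegree := natDegree_prod_le _ _
      _ ≤ ∑ i ∈ e.support, e i * (k - 1) := Finset.sum_le_sum fun i _ =>
          natDegree_pow_le.trans (Nat.mul_le_mul_left _ (hu i))
      _ = (k - 1) * e.degree := by
          rw [← Finset.sum_mul, mul_comm]; rfl
      _ ≤ (k - 1) * D := Nat.mul_le_mul_left _ he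
  have key := congrArg (eval (β j)) (Lagrange.eq_interpolate (hα.injOn (s := (S : Set _))) hdeg)
  rw [Lagrange.interpolate_apply, eval_finsetSum, hQ] at key
  simp only [huβ] at key
  refine key.trans (Finset.sum_congr rfl fun v _ => ?_)
  rw [eval_mul, eval_C, hQ, mul_comm]
  simp only [huα]
  rfl

lemma canRecover_repetition {D : ℕ} {G : Matrix (Fin n × Fin r) (Fin k) F}
    {a : Fin n × Fin r → Fin k} (hG : ∀ v j, G v j = if a v = j then 1 else 0)
    {S : Finset (Fin n × Fin r)} (hS : ∀ j, ∃ v ∈ S, a v = j) : CanRecover V W D G S := by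
  classical
  choose v hvS hv using hS
  intro f _
  refine ⟨fun y j => y ⟨v j, hvS j⟩, fun X => ?_⟩
  funext j
  simp [encode, hG, hv]

/-- A Lagrange code has recovery threshold at most `K*`. -/
theorem IsLagrangeCode.recoveryThreshold_le (C : CloudSystem)
    {G : Matrix (Fin C.n × Fin C.r) (Fin C.k) F} (hG : IsLagrangeCode C.deg G) :
    recoveryThreshold V W C.deg G ≤ C.kStar := by
  classical
  refine Nat.sInf_le fun S hS => ?_
  rcases hG with ⟨h, α, β, hα, hβ, hG⟩ | ⟨h, a, ha, hG⟩
  · rw [CloudSystem.kStar, if_pos h] at hS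
    exact canRecover_lagrange hα hβ hG (by omega)
  · rw [CloudSystem.kStar, if_neg (by omega)] at hS
    refine canRecover_repetition hG fun j => ?_
    by_contra! hj
    -- An input missing from `S` would leave all its copies, at least `⌊nr/k⌋`, outside `S`, while
    -- only `⌊nr/k⌋ - 1` chunks lie outside.
    have hfl : C.n * C.r / C.k ≤ (Finset.univ.filter fun v => a v = j).card := by
      rcases ha j with h | h <;> rw [h]
      rw [Nat.ceilDiv_eq_add_pred_div]
      exact Nat.div_le_div_right (by have := C.k_pos; omega)
    have hdisj : Disjoint S (Finset.univ.filter fun v => a v = j) :=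
      Finset.disjoint_left.2 fun v hv hv' => hj v hv (Finset.mem_filter.1 hv').2
    have := (S ∪ Finset.univ.filter fun v => a v = j).card_le_univ
    rw [Finset.card_union_of_disjoint hdisj, Fintype.card_prod, Fintype.card_fin,
      Fintype.card_fin] at this
    omega

theorem IsLagrangeCode.recoveryThreshold_eq [Nontrivial W] (C : CloudSystem)
    (hD : C.deg ≤ Module.finrank F V)
    {G : Matrix (Fin C.n × Fin C.r) (Fin C.k) F} (hG : IsLagrangeCode C.deg G) :
    recoveryThreshold V W C.deg G = C.kStar :=
  (hG.recoveryThreshold_le C).antisymm (kStar_le_recoveryThreshold C hD G)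

end Achievability

/-! ### Independent Bernoulli trials -/

section Bernoulli

variable {ι κ : Type*}

/-- The probability of the outcome `s` of independent trials with success probabilities `p`. -/
noncomputable def outcomeWeight [Fintype ι] (p : ι → ℝ) (s : ι → Bool) : ℝ :=
  ∏ i, if s i then p i else 1 - p i

lemma outcomeWeight_nonneg [Fintype ι] {p : ι → ℝ} (hp : ∀ i, 0 ≤ p i ∧ p i ≤ 1) (s : ι → Bool) :
    0 ≤ outcomeWeight p s :=
  Finset.prod_nonneg fun i _ => by split_ifs <;> linarith [hp i]

variable [DecidableEq ι] [DecidableEq κ]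

/-- The probability that, among independent trials indexed by `A` with success probabilities `p`,
exactly those in `B` succeed. -/
noncomputable def subsetWeight (p : ι → ℝ) (A B : Finset ι) : ℝ :=
  (∏ i ∈ B, p i) * ∏ i ∈ A \ B, (1 - p i)

lemma subsetWeight_nonneg {p : ι → ℝ} (hp : ∀ i, 0 ≤ p i ∧ p i ≤ 1) (A B : Finset ι) :
    0 ≤ subsetWeight p A B :=
  mul_nonneg (Finset.prod_nonneg fun i _ => (hp i).1)
    (Finset.prod_nonneg fun i _ => sub_nonneg.2 (hp i).2)

lemma subsetWeight_insert_left (p : ι → ℝ) {A B : Finset ι} {c : ι} (hc : c ∉ A) (hB : B ⊆ A) :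
    subsetWeight p (insert c A) B = (1 - p c) * subsetWeight p A B := by
  have hcB : c ∉ B := fun h => hc (hB h)
  rw [subsetWeight, subsetWeight, Finset.insert_sdiff_of_notMem _ hcB,
    Finset.prod_insert (fun h => hc (Finset.mem_sdiff.1 h).1)]
  ring

lemma subsetWeight_insert_insert (p : ι → ℝ) {A B : Finset ι} {c : ι} (hc : c ∉ A) (hB : B ⊆ A) :
    subsetWeight p (insert c A) (insert c B) = p c * subsetWeight p A B := by
  have hcB : c ∉ B := fun h => hc (hB h)
  have : insert c A \ insert c B = A \ B := by
    ext i
    simp only [Finset.mem_sdiff, Finset.mem_insert]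
    constructor
    · rintro ⟨h | h, h'⟩
      · exact absurd (Or.inl h) h'
      · exact ⟨h, fun h'' => h' (Or.inr h'')⟩
    · rintro ⟨h, h'⟩
      exact ⟨Or.inr h, by rintro (rfl | h''); exacts [hc h, h' h'']⟩
  rw [subsetWeight, subsetWeight, this, Finset.prod_insert hcB]
  ring

lemma sum_powerset_insert_subsetWeight (p : ι → ℝ) {A : Finset ι} {c : ι} (hc : c ∉ A)
    (f : Finset ι → ℝ) :
    ∑ B ∈ (insert c A).powerset, subsetWeight p (insert c A) B * f B =
      (1 - p c) * ∑ B ∈ A.powerset, subsetWeight p A B * f B +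
        p c * ∑ B ∈ A.powerset, subsetWeight p A B * f (insert c B) := by
  rw [Finset.sum_powerset_insert hc, Finset.mul_sum, Finset.mul_sum]
  congr 1 <;> refine Finset.sum_congr rfl fun B hB => ?_
  · rw [subsetWeight_insert_left p hc (Finset.mem_powerset.1 hB), mul_assoc]
  · rw [subsetWeight_insert_insert p hc (Finset.mem_powerset.1 hB), mul_assoc]

/-- Trials outside `A` do not matter for events that concern `A` only. -/
lemma sum_powerset_union_subsetWeight (p : ι → ℝ) (A E : Finset ι) (h : Disjoint A E)
    (f : Finset ι → ℝ) :
    ∑ B ∈ (A ∪ E).powerset, subsetWeight p (A ∪ E) B * f (B ∩ A) =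
      ∑ B ∈ A.powerset, subsetWeight p A B * f B := by
  induction E using Finset.induction_on with
  | empty =>
    rw [Finset.union_empty]
    refine Finset.sum_congr rfl fun B hB => ?_
    rw [Finset.inter_eq_left.2 (Finset.mem_powerset.1 hB)]
  | insert c E hc ih =>
    have hcA : c ∉ A := Finset.disjoint_right.1 h (Finset.mem_insert_self c E)
    have hc' : c ∉ A ∪ E := by simp [hc, hcA]
    rw [Finset.union_insert, sum_powerset_insert_subsetWeight p hc' fun B => f (B ∩ A)]
    have : ∀ B, insert c B ∩ A = B ∩ A := fun B => Finset.insert_inter_of_notMem hcA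
    simp only [this]
    rw [ih (Finset.disjoint_of_subset_right (Finset.subset_insert c E) h)]
    ring

/-- The probability of at least `w` successes among the trials in `A`. -/
noncomputable def tailProb (p : ι → ℝ) (A : Finset ι) (w : ℕ) : ℝ :=
  ∑ B ∈ A.powerset, subsetWeight p A B * if w ≤ B.card then 1 else 0

/-- Condition on trial `c`. Truncated subtraction is harmless: for `w = 0` both tails are total
probabilities. -/
lemma tailProb_insert (p : ι → ℝ) {A : Finset ι} {c : ι} (hc : c ∉ A) (w : ℕ) :
    tailProb p (insert c A) w = (1 - p c) * tailProb p A w + p c * tailProb p A (w - 1) := by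
  rw [tailProb, sum_powerset_insert_subsetWeight p hc fun B => if w ≤ B.card then (1 : ℝ) else 0]
  congr 2
  refine Finset.sum_congr rfl fun B hB => ?_
  have : c ∉ B := fun h => hc (Finset.mem_powerset.1 hB h)
  simp only [Finset.card_insert_of_notMem this, tsub_le_iff_right]

lemma tailProb_anti {p : ι → ℝ} (hp : ∀ i, 0 ≤ p i ∧ p i ≤ 1) (A : Finset ι) {v w : ℕ}
    (h : v ≤ w) : tailProb p A w ≤ tailProb p A v := by
  refine Finset.sum_le_sum fun B _ =>
    mul_le_mul_of_nonneg_left ?_ (subsetWeight_nonneg hp A B)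
  split_ifs <;> first | omega | norm_num

/-- The tail probability increases when trials are replaced by more likely ones. -/
lemma tailProb_image_le {p : ι → ℝ} (hp : ∀ i, 0 ≤ p i ∧ p i ≤ 1) (I : Finset κ) {f g : κ → ι}
    (hf : Function.Injective f) (hg : Function.Injective g) (h : ∀ t ∈ I, p (f t) ≤ p (g t))
    (w : ℕ) : tailProb p (I.image f) w ≤ tailProb p (I.image g) w := by
  induction I using Finset.induction_on generalizing w with
  | empty => simp
  | insert c I hc ih =>
    have hI : ∀ t ∈ I, p (f t) ≤ p (g t) := fun t ht => h t (Finset.mem_insert_of_mem ht)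
    rw [Finset.image_insert, Finset.image_insert,
      tailProb_insert p (by simpa [hf.eq_iff] using hc),
      tailProb_insert p (by simpa [hg.eq_iff] using hc)]
    have h1 := ih hI w
    have h2 := ih hI (w - 1)
    have h3 := tailProb_anti hp (I.image g) (Nat.sub_le w 1)
    have h4 := h c (Finset.mem_insert_self c I)
    have h5 := hp (f c)
    -- First compare the two tails with the weight `p (f c)` kept fixed; then raising the weight to
    -- `p (g c)` moves mass to the larger tail, the one at `w - 1`.
    nlinarith [mul_le_mul_of_nonneg_left h1 (sub_nonneg.2 h5.2),
      mul_le_mul_of_nonneg_left h2 h5.1, mul_nonneg (sub_nonneg.2 h4) (sub_nonneg.2 h3)]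

lemma le_orderEmb {a n : ℕ} (e : Fin a ↪o Fin n) (t : Fin a) : (t : ℕ) ≤ e t := by
  obtain ⟨t, ht⟩ := t
  induction t with
  | zero => simp
  | succ t ih =>
    have h1 := ih (by omega)
    have h2 : e ⟨t, by omega⟩ < e ⟨t + 1, ht⟩ := e.strictMono (by simp)
    have h3 := Fin.lt_def.1 h2
    simp only at h1 ⊢
    omega

/-- Among all sets of `a` trials, the `a` most likely ones have the largest tail probabilities. -/
lemma tailProb_le_tailProb_first {n : ℕ} {p : Fin n → ℝ} (hp : ∀ i, 0 ≤ p i ∧ p i ≤ 1)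
    {σ : Equiv.Perm (Fin n)} (hσ : Antitone (p ∘ σ)) (A : Finset (Fin n)) (w : ℕ) :
    tailProb p A w ≤
      tailProb p ((Finset.univ.filter fun j : Fin n => j.val < A.card).image σ) w := by
  have hcard : (A.image σ.symm).card = A.card := Finset.card_image_of_injective _ σ.symm.injective
  have hle : A.card ≤ n := by simpa using A.card_le_univ
  -- List `A` by increasing rank in the order `σ`. Its `t`-th member has rank at least `t`, hence is
  -- at most as likely as the worker of rank `t`.
  let e := (A.image σ.symm).orderEmbOfFin hcard
  have hA : Finset.univ.image (fun t => σ (e t)) = A := by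
    have : Finset.univ.image e = A.image σ.symm := Finset.image_orderEmbOfFin_univ _ hcard
    rw [show (fun t => σ (e t)) = σ ∘ e from rfl, ← Finset.image_image, this, Finset.image_image]
    simp
  have hfirst : Finset.univ.image (fun t => σ (Fin.castLE hle t)) =
      (Finset.univ.filter fun j : Fin n => j.val < A.card).image σ := by
    rw [show (fun t => σ (Fin.castLE hle t)) = σ ∘ Fin.castLE hle from rfl, ← Finset.image_image]
    congr 1
    ext j
    simp only [Finset.mem_image, Finset.mem_univ, true_and, Finset.mem_filter]
    constructor
    · rintro ⟨t, rfl⟩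
      simp
    · intro hj
      exact ⟨⟨j, hj⟩, rfl⟩
  rw [← hfirst]
  conv_lhs => rw [← hA]
  refine tailProb_image_le hp Finset.univ (σ.injective.comp e.injective)
    (σ.injective.comp (Fin.castLE_injective hle)) (fun t _ => ?_) w
  exact hσ (Fin.le_def.2 (le_orderEmb e t))

lemma sum_outcomeWeight_eq [Fintype ι] (p : ι → ℝ) (f : Finset ι → ℝ) :
    ∑ s : ι → Bool, outcomeWeight p s * f (Finset.univ.filter fun i => s i = true) =
      ∑ B ∈ (Finset.univ : Finset ι).powerset, subsetWeight p Finset.univ B * f B := by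
  refine Finset.sum_bij' (fun s _ => Finset.univ.filter fun i => s i = true)
    (fun B _ i => decide (i ∈ B)) (by simp) (by simp) ?_ ?_ ?_
  · intro s _
    funext i
    simp
  · intro B _
    ext i
    simp
  · intro s _
    congr 1
    rw [outcomeWeight, Finset.prod_ite, subsetWeight]
    congr 2
    ext i
    simp

lemma sum_outcomeWeight [Fintype ι] (p : ι → ℝ) : ∑ s : ι → Bool, outcomeWeight p s = 1 := by
  have h1 := sum_outcomeWeight_eq p fun _ => 1
  have h2 := sum_powerset_union_subsetWeight p ∅ Finset.univ (by simp) fun _ => 1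
  rw [Finset.empty_union] at h2
  rw [h2] at h1
  simpa [subsetWeight] using h1

end Bernoulli

/-! ### Success probabilities of load allocations -/

namespace CloudSystem

variable (C : CloudSystem)

lemma speed_pos (b : Bool) : 0 < C.speed b := by
  unfold speed
  split_ifs
  · exact C.muB_pos.trans C.muB_lt_muG
  · exact C.muB_pos

lemma div_speed_le_iff (ℓ : ℕ) (b : Bool) :
    (ℓ : ℝ) / C.speed b ≤ C.d ↔ ℓ ≤ ⌊C.speed b * C.d⌋₊ := by
  rw [div_le_iff₀ (C.speed_pos b), Nat.le_floor_iff (mul_pos (C.speed_pos b) C.d_pos).le, mul_comm]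

lemma kStar_le : C.kStar ≤ C.n * C.r + 1 := by
  unfold kStar
  split_ifs with h
  · have h1 : (C.k - 1) * C.deg + C.deg = C.k * C.deg := by
      rw [Nat.sub_mul, one_mul, Nat.sub_add_cancel (Nat.le_mul_of_pos_left _ C.k_pos)]
    have := C.deg_pos
    omega
  · exact Nat.succ_le_succ (Nat.sub_le _ _)

variable {C}

/-- Only `ℓ_g` is capped at `r`; that `ℓ_b ≤ r` as well follows from `n ℓ_b < K* ≤ nr + 1`. -/
lemma loadB_le_loadG (hK : C.n * C.loadB < C.kStar) : C.loadB ≤ C.loadG := by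
  refine le_min (Nat.floor_le_floor ?_) ?_
  · exact mul_le_mul_of_nonneg_right C.muB_lt_muG.le C.d_pos.le
  · have h : C.n * C.loadB ≤ C.n * C.r := by have := C.kStar_le; omega
    exact Nat.le_of_mul_le_mul_left h C.n_pos

/-- Load `ℓ_g` for the workers in `A` and `ℓ_b` for the others. -/
noncomputable def loadOn (C : CloudSystem) (A : Finset (Fin C.n)) : Fin C.n → ℕ :=
  fun i => if i ∈ A then C.loadG else C.loadB

/-- The probability that a load allocation provides `K*` results in time, if the workers are
independently good with probabilities `p`. -/
noncomputable def succProb (C : CloudSystem) (p : Fin C.n → ℝ) (ℓ : Fin C.n → ℕ) : ℝ :=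
  ∑ s, outcomeWeight p s * if C.kStar ≤ C.received ℓ s then 1 else 0

/-- The largest success probability of an allocation with loads `ℓ_g` and `ℓ_b`. -/
noncomputable def bestProb (C : CloudSystem) (p : Fin C.n → ℝ) : ℝ :=
  Finset.univ.sup' Finset.univ_nonempty fun A => C.succProb p (C.loadOn A)

lemma succProb_loadOn_le_bestProb (p : Fin C.n → ℝ) (A : Finset (Fin C.n)) :
    C.succProb p (C.loadOn A) ≤ C.bestProb p :=
  Finset.le_sup' (fun A => C.succProb p (C.loadOn A)) (Finset.mem_univ A)

lemma continuous_succProb (ℓ : Fin C.n → ℕ) : Continuous fun p => C.succProb p ℓ := by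
  unfold succProb outcomeWeight
  refine continuous_finsetSum _ fun s _ => Continuous.mul ?_ continuous_const
  refine continuous_finsetProd _ fun i _ => ?_
  split_ifs <;> fun_prop

/-- Every load allocation is dominated by one that only uses the loads `ℓ_g` and `ℓ_b`. -/
lemma exists_received_le (ℓ : Fin C.n → ℕ) (hℓ : ∀ i, ℓ i ≤ C.r) :
    ∃ A, ∀ s, C.received ℓ s ≤ C.received (C.loadOn A) s := by
  classical
  have hBG : ⌊C.muB * C.d⌋₊ ≤ ⌊C.muG * C.d⌋₊ :=
    Nat.floor_le_floor (mul_le_mul_of_nonneg_right C.muB_lt_muG.le C.d_pos.le)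
  -- A load up to `ℓ_b` arrives in either state and may be raised to `ℓ_b`; a load above `⌊μ_g d⌋`
  -- never arrives. The loads in between arrive in the good state only and may be raised to `ℓ_g`.
  refine ⟨Finset.univ.filter fun i => C.loadB < ℓ i ∧ ℓ i ≤ ⌊C.muG * C.d⌋₊, fun s => ?_⟩
  refine Finset.sum_le_sum fun i _ => ?_
  have hr := hℓ i
  have hG : C.loadG = min ⌊C.muG * C.d⌋₊ C.r := rfl
  have hB : C.loadB = ⌊C.muB * C.d⌋₊ := rfl
  have hspeed : ⌊C.speed (s i) * C.d⌋₊ = if s i then ⌊C.muG * C.d⌋₊ else ⌊C.muB * C.d⌋₊ := by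
    cases s i <;> rfl
  by_cases hc : C.loadB < ℓ i ∧ ℓ i ≤ ⌊C.muG * C.d⌋₊
  · rw [show C.loadOn _ i = C.loadG from if_pos (by simpa using hc)]
    simp only [div_speed_le_iff, hspeed]
    split_ifs <;> omega
  · rw [show C.loadOn _ i = C.loadB from if_neg (by simpa using hc)]
    simp only [div_speed_le_iff, hspeed]
    split_ifs <;> omega

lemma succProb_le_bestProb {p : Fin C.n → ℝ}
    (hp : ∀ i, 0 ≤ p i ∧ p i ≤ 1) (ℓ : Fin C.n → ℕ) (hℓ : ∀ i, ℓ i ≤ C.r) :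
    C.succProb p ℓ ≤ C.bestProb p := by
  obtain ⟨A, hA⟩ := exists_received_le ℓ hℓ
  refine le_trans ?_ (succProb_loadOn_le_bestProb p A)
  refine Finset.sum_le_sum fun s _ =>
    mul_le_mul_of_nonneg_left ?_ (outcomeWeight_nonneg hp s)
  have := hA s
  split_ifs <;> first | omega | norm_num

/-- Strictness makes a bad worker with load `ℓ_g` miss the deadline, so that the workers in `A`
contribute only when good. -/
lemma received_loadOn_of_lt (h : C.loadB < C.loadG) (A : Finset (Fin C.n)) (s : Fin C.n → Bool) :
    C.received (C.loadOn A) s =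
      ((Finset.univ.filter fun i => s i = true) ∩ A).card * C.loadG +
        (C.n - A.card) * C.loadB := by
  classical
  have hterm : ∀ i, (if (C.loadOn A i : ℝ) / C.speed (s i) ≤ C.d then C.loadOn A i else 0) =
      (if i ∈ (Finset.univ.filter fun i => s i = true) ∩ A then C.loadG else 0) +
        if i ∈ Aᶜ then C.loadB else 0 := by
    intro i
    have hBG : ⌊C.muB * C.d⌋₊ ≤ ⌊C.muG * C.d⌋₊ :=
      Nat.floor_le_floor (mul_le_mul_of_nonneg_right C.muB_lt_muG.le C.d_pos.le)
    simp only [div_speed_le_iff, loadOn, Finset.mem_filter, Finset.mem_univ, true_and,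
      Finset.mem_inter, Finset.mem_compl]
    unfold loadB loadG at *
    by_cases hi : i ∈ A <;> rcases hs : s i <;>
      simp only [speed, hi, Bool.false_eq_true, if_true, if_false, and_true, and_false,
        not_true_eq_false, not_false_eq_true] <;>
      split_ifs <;> omega
  rw [received, Finset.sum_congr rfl fun i _ => hterm i, Finset.sum_add_distrib,
    Finset.sum_ite_mem, Finset.sum_ite_mem, Finset.univ_inter, Finset.univ_inter,
    Finset.sum_const, Finset.sum_const, Finset.card_compl, Fintype.card_fin, smul_eq_mul,
    smul_eq_mul]

lemma received_loadOn_of_eq (h : C.loadG = C.loadB) (A : Finset (Fin C.n)) (s : Fin C.n → Bool) :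
    C.received (C.loadOn A) s ≤ C.n * C.loadB := by
  calc C.received (C.loadOn A) s ≤ ∑ _i : Fin C.n, C.loadB := by
        refine Finset.sum_le_sum fun i _ => ?_
        simp only [loadOn, h, ite_self]
        split_ifs <;> omega
    _ = C.n * C.loadB := by simp

lemma card_le (A : Finset (Fin C.n)) : A.card ≤ C.n := by simpa using A.card_le_univ

/-- The number of good workers needed by the allocation `loadOn A`. -/
noncomputable def neededGood (C : CloudSystem) (a : ℕ) : ℕ :=
  ⌈((C.kStar : ℝ) - ((C.n : ℝ) - a) * C.loadB) / C.loadG⌉₊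

/-- The natural-number ceiling replaces negative values by `0`, which does not affect comparison
with a cardinality. -/
lemma neededGood_le_iff (h : 0 < C.loadG) (A : Finset (Fin C.n)) (b : ℕ) :
    C.neededGood A.card ≤ b ↔ C.kStar ≤ b * C.loadG + (C.n - A.card) * C.loadB := by
  have h' : (0 : ℝ) < C.loadG := by exact_mod_cast h
  rw [neededGood, Nat.ceil_le, div_le_iff₀ h', ← Nat.cast_sub (card_le A), sub_le_iff_le_add]
  exact_mod_cast Iff.rfl

lemma estSuccess_eq (p : Fin C.n → ℝ) (A : Finset (Fin C.n)) :
    estSuccess p A = if A.card * C.loadG + (C.n - A.card) * C.loadB < C.kStar then 0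
      else tailProb p A (C.neededGood A.card) := by
  unfold estSuccess
  split_ifs
  · rfl
  · rw [tailProb, Finset.sum_powerset]
    rw [show Finset.Icc ⌈((C.kStar : ℝ) - ((C.n : ℝ) - A.card) * C.loadB) / C.loadG⌉₊ A.card =
      (Finset.range (A.card + 1)).filter fun l => C.neededGood A.card ≤ l by
        ext l
        rw [Finset.mem_filter, Finset.mem_Icc, Finset.mem_range, Nat.lt_succ_iff]
        exact and_comm, Finset.sum_filter]
    refine Finset.sum_congr rfl fun l _ => ?_
    split_ifs with hl
    · refine Finset.sum_congr rfl fun B hB => ?_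
      rw [(Finset.mem_powersetCard.1 hB).2, if_pos hl, mul_one]
      rfl
    · refine (Finset.sum_eq_zero fun B hB => ?_).symm
      rw [(Finset.mem_powersetCard.1 hB).2, if_neg hl, mul_zero]

/-- The estimated success probability of LEA is the success probability for the estimates. -/
lemma estSuccess_eq_succProb (hK : C.n * C.loadB < C.kStar) (p : Fin C.n → ℝ)
    (A : Finset (Fin C.n)) : estSuccess p A = C.succProb p (C.loadOn A) := by
  classical
  rw [estSuccess_eq]
  -- If `ℓ_g = ℓ_b`, at most `n ℓ_b < K*` results can arrive and both sides are `0`. This also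
  -- disposes of `ℓ_g = 0`, where the quotient in the definition is meaningless.
  rcases (loadB_le_loadG hK).eq_or_lt with h | h
  · have hA := card_le A
    rw [if_pos, succProb, Finset.sum_eq_zero]
    · intro s _
      have := received_loadOn_of_eq h.symm A s
      rw [if_neg (by omega), mul_zero]
    · rw [← h, ← add_mul, Nat.add_sub_cancel' hA]
      exact hK
  · have hG : 0 < C.loadG := by omega
    simp only [succProb, received_loadOn_of_lt h]
    rw [sum_outcomeWeight_eq p fun B =>
      if C.kStar ≤ (B ∩ A).card * C.loadG + (C.n - A.card) * C.loadB then (1 : ℝ) else 0]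
    have hu : A ∪ Aᶜ = Finset.univ := Finset.union_compl A
    have := sum_powerset_union_subsetWeight p A Aᶜ disjoint_compl_right fun B =>
      if C.kStar ≤ B.card * C.loadG + (C.n - A.card) * C.loadB then (1 : ℝ) else 0
    rw [hu] at this
    rw [this]
    split_ifs with hlt
    · refine (Finset.sum_eq_zero fun B hB => ?_).symm
      have hB := Nat.mul_le_mul_right C.loadG
        (Finset.card_le_card (Finset.mem_powerset.1 hB))
      rw [if_neg (by omega), mul_zero]
    · simp only [tailProb, neededGood_le_iff hG]

lemma card_firstWorkers (σ : Equiv.Perm (Fin C.n)) {a : ℕ} (ha : a ≤ C.n) :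
    (firstWorkers σ a).card = a := by
  rw [firstWorkers, Finset.card_image_of_injective _ σ.injective, Fin.card_filter_val_lt,
    min_eq_right ha]

/-- The estimate-and-allocate rule is optimal for the probabilities it uses. -/
lemma exists_estimate_of_isEALoad (hK : C.n * C.loadB < C.kStar) {m : ℕ} {h : C.History m}
    {ℓ : Fin C.n → ℕ} (hℓ : IsEALoad h ℓ) :
    ∃ p, (∀ i, IsEstimate h i (p i)) ∧ ∃ A, ℓ = C.loadOn A ∧
      ∀ B, C.succProb p (C.loadOn B) ≤ C.succProb p (C.loadOn A) := by
  obtain ⟨p, σ, a, hp, hσ, ha, hmax, hℓ⟩ := hℓ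
  have hp' : ∀ i, 0 ≤ p i ∧ p i ≤ 1 := fun i => ⟨(hp i).1, (hp i).2.1⟩
  refine ⟨p, hp, firstWorkers σ a, funext hℓ, fun B => ?_⟩
  simp only [← estSuccess_eq_succProb hK]
  -- The algorithm does not try `a = 0`; the empty set has success probability `0` anyway. Any other
  -- `B` loses to the first `|B|` workers, which need equally many good ones.
  rcases B.eq_empty_or_nonempty with rfl | hB
  · rw [estSuccess_eq, if_pos (by simpa using hK), estSuccess_eq_succProb hK]
    exact Finset.sum_nonneg fun s _ =>
      mul_nonneg (outcomeWeight_nonneg hp' s) (by split_ifs <;> norm_num)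
  · refine le_trans ?_ (hmax B.card (Finset.mem_Icc.2 ⟨hB.card_pos, card_le B⟩))
    rw [estSuccess_eq, estSuccess_eq, card_firstWorkers σ (card_le B)]
    split_ifs
    · exact le_rfl
    · exact tailProb_le_tailProb_first hp' hσ B _

end CloudSystem

/-! ### The Poisson equation of a finite Markov chain -/

section Poisson

variable {E : Type*} [Fintype E] {P : E → E → ℝ}

/-- A function that is at least its one-step average at one of its minima is constant. -/
lemma eq_of_average_le_of_isMin (hP : ∀ s t, 0 < P s t) (hsum : ∀ s, ∑ t, P s t = 1) {g : E → ℝ}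
    {s : E} (hmin : ∀ t, g s ≤ g t) (h : ∑ t, P s t * g t ≤ g s) (t : E) : g t = g s := by
  have h0 : ∑ t, P s t * (g t - g s) ≤ 0 := by
    simp only [mul_sub, Finset.sum_sub_distrib, ← Finset.sum_mul, hsum s]
    linarith
  have hnn : ∀ t ∈ Finset.univ, 0 ≤ P s t * (g t - g s) := fun t _ =>
    mul_nonneg (hP s t).le (sub_nonneg.2 (hmin t))
  have := (Finset.sum_eq_zero_iff_of_nonneg hnn).1 (h0.antisymm (Finset.sum_nonneg hnn)) t
    (Finset.mem_univ t)
  rcases mul_eq_zero.1 this with h | h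
  · exact absurd h (hP s t).ne'
  · linarith

lemma average_le_of_isMax (hP : ∀ s t, 0 < P s t) (hsum : ∀ s, ∑ t, P s t = 1) {g : E → ℝ}
    {s : E} (hmax : ∀ t, g t ≤ g s) : ∑ t, P s t * g t ≤ g s := by
  calc ∑ t, P s t * g t ≤ ∑ t, P s t * g s :=
        Finset.sum_le_sum fun t _ => mul_le_mul_of_nonneg_left (hmax t) (hP s t).le
    _ = g s := by rw [← Finset.sum_mul, hsum, one_mul]

lemma le_average_of_isMin (hP : ∀ s t, 0 < P s t) (hsum : ∀ s, ∑ t, P s t = 1) {g : E → ℝ}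
    {s : E} (hmin : ∀ t, g s ≤ g t) : g s ≤ ∑ t, P s t * g t := by
  calc g s = ∑ t, P s t * g s := by rw [← Finset.sum_mul, hsum, one_mul]
    _ ≤ ∑ t, P s t * g t :=
        Finset.sum_le_sum fun t _ => mul_le_mul_of_nonneg_left (hmin t) (hP s t).le

/-- Solvability of the Poisson equation `f = c + g - P g` for a positive stochastic matrix `P`. -/
theorem exists_poisson_solution [Nonempty E] (hP : ∀ s t, 0 < P s t) (hsum : ∀ s, ∑ t, P s t = 1)
    (f : E → ℝ) :
    ∃ (c : ℝ) (g : E → ℝ), ∀ s, f s = c + (g s - ∑ t, P s t * g t) := by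
  obtain ⟨s₀⟩ := ‹Nonempty E›
  -- The kernel of `1 - P` consists of the constants; adding `g s₀` makes the operator injective,
  -- hence bijective in finite dimension, and `g s₀` becomes the constant `c`.
  let T : (E → ℝ) →ₗ[ℝ] (E → ℝ) :=
    { toFun := fun g s => g s₀ + (g s - ∑ t, P s t * g t)
      map_add' := fun g h => by
        funext s
        simp only [Pi.add_apply, mul_add, Finset.sum_add_distrib]
        ring
      map_smul' := fun a g => by
        funext s
        simp only [Pi.smul_apply, smul_eq_mul, RingHom.id_apply, mul_add, mul_sub, Finset.mul_sum]
        simp only [mul_left_comm] }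
  have hinj : Function.Injective T := by
    rw [← LinearMap.ker_eq_bot, LinearMap.ker_eq_bot']
    intro g hg
    have hg' : ∀ s, g s₀ + (g s - ∑ t, P s t * g t) = 0 := fun s => congrFun hg s
    obtain ⟨s, hs⟩ := Finite.exists_max g
    obtain ⟨u, hu⟩ := Finite.exists_min g
    have h1 := average_le_of_isMax hP hsum hs
    have h2 := le_average_of_isMin hP hsum hu
    have h3 := hg' s
    have h4 := hg' u
    have h5 := eq_of_average_le_of_isMin hP hsum hu (by linarith)
    funext t
    rw [Pi.zero_apply, h5 t, ← h5 s₀]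
    linarith
  obtain ⟨g, hg⟩ := LinearMap.injective_iff_surjective.1 hinj f
  exact ⟨g s₀, g, fun s => (congrFun hg s).symm⟩

/-- The constant in the Poisson equation of a nonzero non-negative function is positive. -/
lemma poisson_const_pos [Nonempty E] (hP : ∀ s t, 0 < P s t)
    (hsum : ∀ s, ∑ t, P s t = 1) {f g : E → ℝ}
    {c : ℝ} (h : ∀ s, f s = c + (g s - ∑ t, P s t * g t)) (hf : ∀ s, 0 ≤ f s) {s₁ : E} (h₁ : 0 < f s₁) :
    0 < c := by
  by_contra! hc
  -- With `c ≤ 0` and `f u ≥ 0`, the minimum of `g` dominates its average, so `g` is constant and `f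
  -- s₁ = c ≤ 0`.
  obtain ⟨u, hu⟩ := Finite.exists_min g
  have hgu := eq_of_average_le_of_isMin hP hsum hu (by linarith [h u, hf u])
  have h2 := h s₁
  simp only [hgu, ← Finset.sum_mul, hsum] at h2
  linarith

end Poisson

/-! ### A strong law of large numbers for bounded orthogonal random variables -/

section Orthogonal

/-- Adding `B` makes the terms nonnegative and the partial sums monotone; since consecutive squares
have ratio tending to `1`, the averages between them are controlled. -/
lemma tendsto_average_of_tendsto_average_sq {x : ℕ → ℝ} {B : ℝ} (hx : ∀ m, |x m| ≤ B)
    (h : Tendsto (fun N : ℕ => (∑ m ∈ Finset.range ((N + 1) ^ 2), x m) / ((N + 1) ^ 2 : ℕ))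
      atTop (𝓝 0)) :
    Tendsto (fun M : ℕ => (∑ m ∈ Finset.range M, x m) / M) atTop (𝓝 0) := by
  have hmono : Monotone fun M : ℕ => ∑ m ∈ Finset.range M, (x m + B) := by
    refine monotone_nat_of_le_succ fun M => ?_
    rw [Finset.sum_range_succ]
    linarith [(abs_le.1 (hx M)).1]
  have hsplit : ∀ M : ℕ, 0 < M → (∑ m ∈ Finset.range M, (x m + B)) / M =
      (∑ m ∈ Finset.range M, x m) / M + B := by
    intro M hM
    have : (M : ℝ) ≠ 0 := by positivity
    rw [Finset.sum_add_distrib, Finset.sum_const, Finset.card_range, nsmul_eq_mul]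
    field_simp
  have key := tendsto_div_of_monotone_of_exists_subseq_tendsto_div _ B hmono fun a ha => by
    refine ⟨fun N => (N + 1) ^ 2, ?_, ?_, ?_⟩
    · have h1 : Tendsto (fun N : ℕ => (1 + 1 / ((N : ℝ) + 1)) ^ 2) atTop (𝓝 ((1 + 0) ^ 2)) :=
        (tendsto_one_div_add_atTop_nhds_zero_nat.const_add 1).pow 2
      rw [add_zero, one_pow] at h1
      filter_upwards [h1.eventually (ge_mem_nhds ha)] with N hN
      have h2 : (0 : ℝ) < (N : ℝ) + 1 := by positivity
      push_cast
      calc ((N : ℝ) + 1 + 1) ^ 2 = (1 + 1 / ((N : ℝ) + 1)) ^ 2 * ((N : ℝ) + 1) ^ 2 := by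
            field_simp
        _ ≤ a * ((N : ℝ) + 1) ^ 2 := by gcongr
    · exact tendsto_atTop_mono (fun N => by simp only [id]; nlinarith) tendsto_id
    · have h1 := h.add_const B
      rw [zero_add] at h1
      refine h1.congr fun N => ?_
      rw [hsplit _ (by positivity)]
  have h1 := key.sub_const B
  rw [sub_self] at h1
  refine h1.congr' ?_
  filter_upwards [eventually_gt_atTop 0] with M hM
  rw [hsplit M hM, add_sub_cancel_right]

variable {Ω : Type*} [MeasurableSpace Ω] {μ : Measure Ω}

/-- Random variables with summable expectations of squares converge to zero. -/
lemma ae_tendsto_zero_of_summable_integral_sq {Y : ℕ → Ω → ℝ} (hY : ∀ N, Measurable (Y N))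
    (hint : ∀ N, Integrable (fun ω => Y N ω ^ 2) μ)
    (hsum : Summable fun N => ∫ ω, Y N ω ^ 2 ∂μ) :
    ∀ᵐ ω ∂μ, Tendsto (fun N => Y N ω) atTop (𝓝 0) := by
  have hmeas : ∀ N, Measurable fun ω => ENNReal.ofReal (Y N ω ^ 2) := fun N =>
    ((hY N).pow_const 2).ennreal_ofReal
  have hfin : ∫⁻ ω, ∑' N, ENNReal.ofReal (Y N ω ^ 2) ∂μ ≠ ⊤ := by
    rw [lintegral_tsum fun N => (hmeas N).aemeasurable]
    simp only [← ofReal_integral_eq_lintegral_ofReal (hint _) (ae_of_all _ fun ω => sq_nonneg _)]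
    exact hsum.tsum_ofReal_ne_top
  filter_upwards [ae_lt_top (Measurable.tsum hmeas) hfin] with ω hω
  have h1 := ENNReal.tendsto_atTop_zero_of_tsum_ne_top hω.ne
  have h2 := (ENNReal.tendsto_toReal ENNReal.zero_ne_top).comp h1
  simp only [Function.comp_def, ENNReal.toReal_ofReal (sq_nonneg _), ENNReal.toReal_zero] at h2
  have h3 := (Real.continuous_sqrt.tendsto 0).comp h2
  simp only [Function.comp_def, Real.sqrt_sq_eq_abs, Real.sqrt_zero] at h3
  exact (tendsto_zero_iff_abs_tendsto_zero _).2 h3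

variable [IsProbabilityMeasure μ]

lemma integrable_of_measurable_of_abs_le {f : Ω → ℝ} {B : ℝ} (hf : Measurable f)
    (h : ∀ ω, |f ω| ≤ B) : Integrable f μ :=
  Integrable.of_bound hf.aestronglyMeasurable B (ae_of_all _ h)

lemma integral_sq_sum_le {X : ℕ → Ω → ℝ} {B : ℝ} (hX : ∀ m, Measurable (X m))
    (hB : ∀ m ω, |X m ω| ≤ B) (horth : ∀ i j, i < j → ∫ ω, X i ω * X j ω ∂μ = 0) (M : ℕ) :
    ∫ ω, (∑ m ∈ Finset.range M, X m ω) ^ 2 ∂μ ≤ M * B ^ 2 := by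
  have hmul : ∀ i j, Integrable (fun ω => X i ω * X j ω) μ := fun i j =>
    integrable_of_measurable_of_abs_le (B := B * B) ((hX i).mul (hX j)) fun ω => by
      rw [abs_mul]
      exact mul_le_mul (hB i ω) (hB j ω) (abs_nonneg _) ((abs_nonneg _).trans (hB i ω))
  have hsq : ∀ M, Integrable (fun ω => (∑ m ∈ Finset.range M, X m ω) ^ 2) μ := fun M => by
    simp only [sq, Finset.sum_mul_sum]
    exact integrable_finsetSum _ fun i _ => integrable_finsetSum _ fun j _ => hmul i j
  induction M with
  | zero => simp
  | succ M ih =>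
    have hcross : Integrable (fun ω => ∑ i ∈ Finset.range M, X i ω * X M ω) μ :=
      integrable_finsetSum _ fun i _ => hmul i M
    have hstep : ∀ ω, (∑ m ∈ Finset.range (M + 1), X m ω) ^ 2 =
        (∑ m ∈ Finset.range M, X m ω) ^ 2 + 2 * (∑ i ∈ Finset.range M, X i ω * X M ω) +
          X M ω * X M ω := fun ω => by
      rw [Finset.sum_range_succ, ← Finset.sum_mul]
      ring
    have hadd : Integrable (fun ω => (∑ m ∈ Finset.range M, X m ω) ^ 2 +
        2 * ∑ i ∈ Finset.range M, X i ω * X M ω) μ := (hsq M).add (hcross.const_mul 2)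
    simp only [hstep]
    rw [integral_add hadd (hmul M M),
      integral_add (hsq M) (hcross.const_mul 2), integral_const_mul,
      integral_finsetSum _ fun i _ => hmul i M,
      Finset.sum_eq_zero fun i hi => horth i M (Finset.mem_range.1 hi)]
    have : ∫ ω, X M ω * X M ω ∂μ ≤ B ^ 2 := by
      calc ∫ ω, X M ω * X M ω ∂μ ≤ ∫ _ω, B ^ 2 ∂μ := by
            refine integral_mono (hmul M M) (integrable_const _) fun ω => ?_
            have := hB M ω
            simp only [← sq]
            rw [← sq_abs]
            gcongr
        _ = B ^ 2 := by simp
    push_cast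
    linarith

/-- The averages of bounded, pairwise orthogonal random variables tend to zero almost surely. -/
theorem ae_tendsto_average_of_orthogonal {X : ℕ → Ω → ℝ} {B : ℝ} (hX : ∀ m, Measurable (X m))
    (hB : ∀ m ω, |X m ω| ≤ B) (horth : ∀ i j, i < j → ∫ ω, X i ω * X j ω ∂μ = 0) :
    ∀ᵐ ω ∂μ, Tendsto (fun M : ℕ => (∑ m ∈ Finset.range M, X m ω) / M) atTop (𝓝 0) := by
  have hle : ∀ (M : ℕ) ω, |∑ m ∈ Finset.range M, X m ω| ≤ M * B := fun M ω =>
    (Finset.abs_sum_le_sum_abs _ _).trans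
      ((Finset.sum_le_sum fun m _ => hB m ω).trans_eq (by simp))
  have hmeas : ∀ M : ℕ, Measurable fun ω => (∑ m ∈ Finset.range M, X m ω) / (M : ℝ) := fun M =>
    (Finset.measurable_sum _ fun m _ => hX m).div_const _
  have hint : ∀ M : ℕ, Integrable (fun ω => (∑ m ∈ Finset.range M, X m ω) ^ 2) μ := fun M =>
    integrable_of_measurable_of_abs_le (B := (M * B) ^ 2)
      ((Finset.measurable_sum _ fun m _ => hX m).pow_const 2) fun ω => by
        rw [abs_pow]
        exact pow_le_pow_left₀ (abs_nonneg _) (hle M ω) 2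
  -- Second moments of the averages are only `O(1/M)`, which is not summable over all `M` but is
  -- along the squares.
  have hbound : ∀ N : ℕ, ∫ ω, ((∑ m ∈ Finset.range ((N + 1) ^ 2), X m ω) /
      ((N + 1) ^ 2 : ℕ)) ^ 2 ∂μ ≤ B ^ 2 * (1 / ((N + 1 : ℕ) : ℝ) ^ 2) := fun N => by
    simp only [div_pow]
    rw [integral_div, div_le_iff₀ (by positivity)]
    refine (integral_sq_sum_le hX hB horth _).trans_eq ?_
    push_cast
    field_simp
  have hae := ae_tendsto_zero_of_summable_integral_sq (μ := μ)
    (Y := fun N ω => (∑ m ∈ Finset.range ((N + 1) ^ 2), X m ω) / ((N + 1) ^ 2 : ℕ))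
    (fun N => hmeas _)
    (fun N => by simp only [div_pow]; exact (hint _).div_const _)
    (Summable.of_nonneg_of_le (fun N => integral_nonneg fun ω => sq_nonneg _) hbound
      (((summable_nat_add_iff 1).2 (Real.summable_one_div_nat_pow.2 one_lt_two)).mul_left _))
  filter_upwards [hae] with ω hω
  exact tendsto_average_of_tendsto_average_sq (fun m => hB m ω) hω

end Orthogonal

/-! ### The joint chain of the workers -/

section Transition

variable {ι : Type*}

/-- The probability that worker `i` is good in the next round, given the current states `s`. -/
noncomputable def goodProb (pGG pBB : ι → ℝ) (s : ι → Bool) (i : ι) : ℝ :=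
  trans (pGG i) (pBB i) (s i) true

variable {pGG pBB : ι → ℝ}

lemma goodProb_mem (hGG : ∀ i, 0 < pGG i ∧ pGG i < 1) (hBB : ∀ i, 0 < pBB i ∧ pBB i < 1)
    (s : ι → Bool) (i : ι) : 0 < goodProb pGG pBB s i ∧ goodProb pGG pBB s i < 1 := by
  unfold goodProb
  have h1 := hGG i
  have h2 := hBB i
  cases s i <;> simp only [trans] <;> constructor <;> linarith

variable [Fintype ι]

lemma outcomeWeight_goodProb (s s' : ι → Bool) :
    outcomeWeight (goodProb pGG pBB s) s' = ∏ i, trans (pGG i) (pBB i) (s i) (s' i) := by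
  refine Finset.prod_congr rfl fun i _ => ?_
  unfold goodProb
  cases s i <;> cases s' i <;> simp [trans]

lemma outcomeWeight_goodProb_pos (hGG : ∀ i, 0 < pGG i ∧ pGG i < 1)
    (hBB : ∀ i, 0 < pBB i ∧ pBB i < 1) (s s' : ι → Bool) :
    0 < outcomeWeight (goodProb pGG pBB s) s' :=
  Finset.prod_pos fun i _ => by
    have := goodProb_mem hGG hBB s i
    split_ifs <;> linarith

lemma sum_outcomeWeight_mul_ite [DecidableEq ι] (p : ι → ℝ) (i : ι) :
    ∑ s : ι → Bool, outcomeWeight p s * (if s i = true then 1 else 0) = p i := by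
  have h1 := sum_outcomeWeight_eq p fun B => if i ∈ B then (1 : ℝ) else 0
  have h2 := sum_powerset_union_subsetWeight p {i} {i}ᶜ disjoint_compl_right
    fun B => if i ∈ B then (1 : ℝ) else 0
  rw [Finset.union_compl] at h2
  simp only [Finset.mem_inter, Finset.mem_singleton, and_true] at h2
  simp only [Finset.mem_filter, Finset.mem_univ, true_and] at h1
  rw [h1, h2, ← insert_empty_eq, Finset.sum_powerset_insert (Finset.notMem_empty i)]
  simp [subsetWeight]

end Transition

/-! ### Joint law of the workers and of the randomization variable; law of large numbers for
martingale differences. -/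

section Chain

variable {ι Ω 𝒵 : Type*} [MeasurableSpace Ω] [MeasurableSpace 𝒵]
  {μ : Measure Ω} {pGG pBB : ι → ℝ} {S : ι → ℕ → Ω → Bool} {Z : Ω → 𝒵}

/-- The states of all workers in rounds `0, …, m - 1`. -/
def history (S : ι → ℕ → Ω → Bool) (m : ℕ) (ω : Ω) : Fin m → ι → Bool := fun t i => S i t ω

/-- The states of all workers in round `m`. -/
def state (S : ι → ℕ → Ω → Bool) (m : ℕ) (ω : Ω) : ι → Bool := fun i => S i m ω

lemma measurable_history (hS : ∀ i m, Measurable (S i m)) (m : ℕ) :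
    Measurable (history S m) :=
  measurable_pi_lambda _ fun t => measurable_pi_lambda _ fun i => hS i t

lemma measurable_state (hS : ∀ i m, Measurable (S i m)) (m : ℕ) : Measurable (state S m) :=
  measurable_pi_lambda _ fun i => hS i m

lemma measurable_comp_of_countable {A : Type*} [MeasurableSpace A] [Countable A]
    [MeasurableSingletonClass A] {G : 𝒵 → A → ℝ} (hG : ∀ a, Measurable fun z => G z a)
    (hZ : Measurable Z) {Y : Ω → A} (hY : Measurable Y) : Measurable fun ω => G (Z ω) (Y ω) :=
  (measurable_from_prod_countable_left (f := fun x : 𝒵 × A => G x.1 x.2) hG).comp (hZ.prodMk hY)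

/-- Functions of the randomization variable are uncorrelated with events about the states. -/
lemma integral_mul_indicator_path [IsProbabilityMeasure μ] (hZ : Measurable Z)
    (hSm : ∀ i m, Measurable (S i m))
    (hZS : IndepFun Z (fun (ω : Ω) (i : ι) (m : ℕ) => S i m ω) μ) {g : 𝒵 → ℝ}
    (hg : Measurable g) {T : Set (ι → ℕ → Bool)} (hT : MeasurableSet T) :
    ∫ ω, g (Z ω) * {ω | (fun i m => S i m ω) ∈ T}.indicator 1 ω ∂μ =
      (∫ ω, g (Z ω) ∂μ) * μ.real {ω | (fun i m => S i m ω) ∈ T} := by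
  have hY : Measurable fun (ω : Ω) (i : ι) (m : ℕ) => S i m ω :=
    measurable_pi_lambda _ fun i => measurable_pi_lambda _ fun m => hSm i m
  have hI : Measurable (T.indicator (1 : (ι → ℕ → Bool) → ℝ)) := measurable_one.indicator hT
  have h := (hZS.comp hg hI).integral_fun_mul_eq_mul_integral
    (hg.comp hZ).aestronglyMeasurable (hI.comp hY).aestronglyMeasurable
  have hset : {ω | (fun i m => S i m ω) ∈ T} = (fun ω i m => S i m ω) ⁻¹' T := rfl
  rw [hset, ← integral_indicator_one (hY hT)]
  exact h

variable [Fintype ι]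

/-- Finite-dimensional distributions of the joint chain. -/
lemma measureReal_path [IsProbabilityMeasure μ]
    (hS : ∀ i, IsStationaryChain μ (pGG i) (pBB i) (S i))
    (hindep : iIndepFun (fun i ω m => S i m ω) μ) (m : ℕ) (s : ℕ → ι → Bool) :
    μ.real {ω | ∀ t ≤ m, state S t ω = s t} = ∏ i, (stationary (pGG i) (pBB i) (s 0 i) *
      ∏ t ∈ Finset.range m, trans (pGG i) (pBB i) (s t i) (s (t + 1) i)) := by
  have hset : {ω | ∀ t ≤ m, state S t ω = s t} =
      ⋂ i ∈ Finset.univ, (fun ω m => S i m ω) ⁻¹' {y : ℕ → Bool | ∀ t ≤ m, y t = s t i} := by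
    ext ω
    simp only [Set.mem_ofPred_eq, state, funext_iff, Finset.mem_univ, Set.iInter_true,
      Set.mem_iInter, Set.mem_preimage]
    exact ⟨fun h i t ht => h t ht i, fun h t ht i => h i t ht⟩
  have hmeas : ∀ i, MeasurableSet {y : ℕ → Bool | ∀ t ≤ m, y t = s t i} := fun i => by
    simp only [Set.ofPred_forall]
    exact MeasurableSet.iInter fun t => MeasurableSet.iInter fun _ =>
      measurableSet_eq_fun (measurable_pi_apply t) measurable_const
  rw [measureReal_def, hset,
    hindep.measure_inter_preimage_eq_mul Finset.univ fun i _ => hmeas i, ENNReal.toReal_prod]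
  exact Finset.prod_congr rfl fun i _ => (hS i).2 m fun t => s t i

/-- The Markov property. -/
lemma measureReal_history_state [IsProbabilityMeasure μ]
    (hS : ∀ i, IsStationaryChain μ (pGG i) (pBB i) (S i))
    (hindep : iIndepFun (fun i ω m => S i m ω) μ) (m : ℕ) (h : Fin (m + 1) → ι → Bool)
    (s' : ι → Bool) :
    μ.real {ω | history S (m + 1) ω = h ∧ state S (m + 1) ω = s'} =
      outcomeWeight (goodProb pGG pBB (h (Fin.last m))) s' *
        μ.real {ω | history S (m + 1) ω = h} := by
  let s : ℕ → ι → Bool := fun t => if ht : t < m + 1 then h ⟨t, ht⟩ else s'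
  have hs : ∀ t (ht : t < m + 1), s t = h ⟨t, ht⟩ := fun t ht => dif_pos ht
  have hs' : s (m + 1) = s' := dif_neg (lt_irrefl _)
  have hhist : ∀ ω, history S (m + 1) ω = h ↔ ∀ t ≤ m, state S t ω = s t := fun ω => by
    constructor
    · rintro rfl t ht
      rw [hs t (by omega)]
      rfl
    · intro H
      funext t
      rw [← hs t t.2]
      exact H t (by omega)
  have hboth : ∀ ω, (history S (m + 1) ω = h ∧ state S (m + 1) ω = s') ↔
      ∀ t ≤ m + 1, state S t ω = s t := fun ω => by
    rw [hhist, ← hs']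
    constructor
    · rintro ⟨h1, h2⟩ t ht
      rcases Nat.le_succ_iff.1 ht with h | rfl
      exacts [h1 t h, h2]
    · exact fun H => ⟨fun t ht => H t (by omega), H _ le_rfl⟩
  simp only [hboth]
  simp only [hhist]
  rw [measureReal_path hS hindep, measureReal_path hS hindep, outcomeWeight_goodProb,
    ← Finset.prod_mul_distrib]
  refine Finset.prod_congr rfl fun i _ => ?_
  rw [Finset.prod_range_succ, hs', hs m (by omega)]
  simp only [Fin.last]
  ring

lemma measurableSet_path_eq (m : ℕ) (h : Fin m → ι → Bool) :
    MeasurableSet {y : ι → ℕ → Bool | (fun (t : Fin m) i => y i t) = h} := by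
  have : Measurable fun (y : ι → ℕ → Bool) (t : Fin m) (i : ι) => y i t := by fun_prop
  exact this (measurableSet_singleton h)

lemma measurableSet_state_eq (m : ℕ) (s : ι → Bool) :
    MeasurableSet {y : ι → ℕ → Bool | (fun i => y i m) = s} := by
  have : Measurable fun (y : ι → ℕ → Bool) (i : ι) => y i m := by fun_prop
  exact this (measurableSet_singleton s)

variable [DecidableEq ι] [IsProbabilityMeasure μ]

/-- The Markov property for functions of the randomization variable and the history. -/
lemma integral_eq_integral_average (hZ : Measurable Z)
    (hS : ∀ i, IsStationaryChain μ (pGG i) (pBB i) (S i))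
    (hindep : iIndepFun (fun i ω m => S i m ω) μ)
    (hZS : IndepFun Z (fun (ω : Ω) (i : ι) (m : ℕ) => S i m ω) μ) (m : ℕ)
    {G : 𝒵 → (Fin (m + 1) → ι → Bool) → (ι → Bool) → ℝ} {B : ℝ}
    (hG : ∀ h s, Measurable fun z => G z h s) (hB : ∀ z h s, |G z h s| ≤ B) :
    ∫ ω, G (Z ω) (history S (m + 1) ω) (state S (m + 1) ω) ∂μ =
      ∫ ω, ∑ s, outcomeWeight (goodProb pGG pBB (state S m ω)) s *
        G (Z ω) (history S (m + 1) ω) s ∂μ := by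
  classical
  have hSm : ∀ i m, Measurable (S i m) := fun i => (hS i).1
  let E : (Fin (m + 1) → ι → Bool) → Set Ω := fun h => {ω | history S (m + 1) ω = h}
  let E' : (Fin (m + 1) → ι → Bool) → (ι → Bool) → Set Ω :=
    fun h s => {ω | history S (m + 1) ω = h ∧ state S (m + 1) ω = s}
  have hE : ∀ h, MeasurableSet (E h) := fun h =>
    measurable_history hSm _ (measurableSet_singleton h)
  have hE' : ∀ h s, MeasurableSet (E' h s) := fun h s =>
    (hE h).inter (measurable_state hSm _ (measurableSet_singleton s))
  have hint : ∀ h s (A : Set Ω), MeasurableSet A →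
      Integrable (fun ω => G (Z ω) h s * A.indicator 1 ω) μ := fun h s A hA => by
    refine integrable_of_measurable_of_abs_le (B := B)
      (((hG h s).comp hZ).mul (measurable_one.indicator hA)) fun ω => ?_
    rw [abs_mul]
    have h0 := hB (Z ω) h s
    by_cases hω : ω ∈ A
    · simpa [hω] using h0
    · simpa [hω] using (abs_nonneg _).trans h0
  -- There are finitely many histories and states, so conditional expectations reduce to finite sums
  -- over atoms, on which `Z` separates by independence.
  have hl : ∀ ω, G (Z ω) (history S (m + 1) ω) (state S (m + 1) ω) =
      ∑ h, ∑ s, G (Z ω) h s * (E' h s).indicator 1 ω := fun ω => by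
    rw [Finset.sum_eq_single (history S (m + 1) ω), Finset.sum_eq_single (state S (m + 1) ω)]
    · simp [E']
    · intro s _ hs
      simp [E', hs.symm]
    · simp
    · intro h _ hh
      simp [E', hh.symm]
    · simp
  have hr : ∀ ω, ∑ s, outcomeWeight (goodProb pGG pBB (state S m ω)) s *
      G (Z ω) (history S (m + 1) ω) s = ∑ h : Fin (m + 1) → ι → Bool, ∑ s,
        outcomeWeight (goodProb pGG pBB (h (Fin.last m))) s *
          (G (Z ω) h s * (E h).indicator 1 ω) := fun ω => by
    rw [Finset.sum_eq_single (history S (m + 1) ω)]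
    · refine Finset.sum_congr rfl fun s _ => ?_
      have : ω ∈ E (history S (m + 1) ω) := rfl
      rw [Set.indicator_of_mem this, Pi.one_apply, mul_one]
      rfl
    · intro h _ hh
      simp [E, hh.symm]
    · simp
  simp only [hl, hr]
  rw [integral_finsetSum _ fun h _ => integrable_finsetSum _ fun s _ => hint h s _ (hE' h s),
    integral_finsetSum _ fun h _ => integrable_finsetSum _ fun s _ =>
      (hint h s _ (hE h)).const_mul _]
  refine Finset.sum_congr rfl fun h _ => ?_
  rw [integral_finsetSum _ fun s _ => hint h s _ (hE' h s),
    integral_finsetSum _ fun s _ => (hint h s _ (hE h)).const_mul _]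
  refine Finset.sum_congr rfl fun s _ => ?_
  rw [integral_const_mul]
  have h1 := integral_mul_indicator_path hZ hSm hZS (hG h s)
    (measurableSet_path_eq (m + 1) h)
  have h2 := integral_mul_indicator_path hZ hSm hZS (hG h s)
    ((measurableSet_path_eq (m + 1) h).inter (measurableSet_state_eq (m + 1) s))
  refine h2.trans ?_
  refine Eq.trans ?_ (congrArg (outcomeWeight (goodProb pGG pBB (h (Fin.last m))) s * ·) h1).symm
  have h3 := measureReal_history_state hS hindep m h s
  calc _ = (∫ ω, G (Z ω) h s ∂μ) * (outcomeWeight (goodProb pGG pBB (h (Fin.last m))) s *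
        μ.real {ω | history S (m + 1) ω = h}) := congrArg _ h3
    _ = outcomeWeight (goodProb pGG pBB (h (Fin.last m))) s * ((∫ ω, G (Z ω) h s ∂μ) *
        μ.real {ω | history S (m + 1) ω = h}) := by ring

/-- The law of large numbers for martingale differences along the joint chain. -/
theorem ae_tendsto_average_sub_average (hZ : Measurable Z)
    (hGG : ∀ i, 0 < pGG i ∧ pGG i < 1) (hBB : ∀ i, 0 < pBB i ∧ pBB i < 1)
    (hS : ∀ i, IsStationaryChain μ (pGG i) (pBB i) (S i))
    (hindep : iIndepFun (fun i ω m => S i m ω) μ)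
    (hZS : IndepFun Z (fun (ω : Ω) (i : ι) (m : ℕ) => S i m ω) μ)
    {G : (m : ℕ) → 𝒵 → (Fin (m + 1) → ι → Bool) → (ι → Bool) → ℝ} {B : ℝ}
    (hG : ∀ m h s, Measurable fun z => G m z h s) (hB : ∀ m z h s, |G m z h s| ≤ B) :
    ∀ᵐ ω ∂μ, Tendsto (fun M : ℕ => (∑ m ∈ Finset.range M,
      (G m (Z ω) (history S (m + 1) ω) (state S (m + 1) ω) -
        ∑ s, outcomeWeight (goodProb pGG pBB (state S m ω)) s *
          G m (Z ω) (history S (m + 1) ω) s)) / M) atTop (𝓝 0) := by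
  have hSm : ∀ i m, Measurable (S i m) := fun i => (hS i).1
  let A : (m : ℕ) → 𝒵 → (Fin (m + 1) → ι → Bool) → ℝ := fun m z h =>
    ∑ s, outcomeWeight (goodProb pGG pBB (h (Fin.last m))) s * G m z h s
  let D : (m : ℕ) → 𝒵 → (Fin (m + 1) → ι → Bool) → (ι → Bool) → ℝ := fun m z h s =>
    G m z h s - A m z h
  have hpos := outcomeWeight_goodProb_pos (pGG := pGG) (pBB := pBB) hGG hBB
  have hA : ∀ m z h, |A m z h| ≤ B := fun m z h => by
    calc |A m z h| ≤ ∑ s, outcomeWeight (goodProb pGG pBB (h (Fin.last m))) s * B := by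
          refine (Finset.abs_sum_le_sum_abs _ _).trans (Finset.sum_le_sum fun s _ => ?_)
          rw [abs_mul, abs_of_pos (hpos _ s)]
          exact mul_le_mul_of_nonneg_left (hB m z h s) (hpos _ s).le
      _ = B := by rw [← Finset.sum_mul, sum_outcomeWeight, one_mul]
  have hD : ∀ m z h s, |D m z h s| ≤ 2 * B := fun m z h s => by
    have h1 := abs_sub (G m z h s) (A m z h)
    have h2 := hB m z h s
    have h3 := hA m z h
    simp only [D]
    linarith
  have hDm : ∀ m h s, Measurable fun z => D m z h s := fun m h s =>
    (hG m h s).sub (Finset.measurable_sum _ fun s _ => (hG m h s).const_mul _)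
  have hD0 : ∀ m z h, ∑ s, outcomeWeight (goodProb pGG pBB (h (Fin.last m))) s * D m z h s = 0 :=
    fun m z h => by
      simp only [D, mul_sub, Finset.sum_sub_distrib, ← Finset.sum_mul, sum_outcomeWeight, one_mul]
      exact sub_self _
  refine ae_tendsto_average_of_orthogonal (B := 2 * B)
    (X := fun m ω => D m (Z ω) (history S (m + 1) ω) (state S (m + 1) ω))
    (fun m => ?_) (fun m ω => hD _ _ _ _) fun i j hij => ?_
  · exact measurable_comp_of_countable (G := fun z (x : (Fin (m + 1) → ι → Bool) × (ι → Bool)) =>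
      D m z x.1 x.2) (fun x => hDm m x.1 x.2) hZ
      ((measurable_history hSm _).prodMk (measurable_state hSm _))
  -- Since `i + 1 ≤ j`, the factor `D i` is a function of `Z` and the rounds up to `j`; it comes out
  -- of the average over the states of round `j + 1`, and the average of `D j` is zero.
  · have h := integral_eq_integral_average hZ hS hindep hZS j (B := 2 * B * (2 * B))
      (G := fun z h s => D i z (fun t => h ⟨t, by omega⟩) (h ⟨i + 1, by omega⟩) * D j z h s)
      (fun h s => (hDm _ _ _).mul (hDm _ _ _)) fun z h s => by
        rw [abs_mul]
        exact mul_le_mul (hD _ _ _ _) (hD _ _ _ _) (abs_nonneg _)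
          ((abs_nonneg _).trans (hD i z (fun t => h ⟨t, by omega⟩) s))
    refine h.trans ?_
    have : ∀ ω, ∑ s, outcomeWeight (goodProb pGG pBB (state S j ω)) s *
        (D i (Z ω) (fun t => history S (j + 1) ω ⟨t, by omega⟩)
          (history S (j + 1) ω ⟨i + 1, by omega⟩) * D j (Z ω) (history S (j + 1) ω) s) = 0 :=
      fun ω => by
        simp only [mul_left_comm (outcomeWeight _ _), ← Finset.mul_sum]
        exact mul_eq_zero_of_right _ (hD0 j (Z ω) (history S (j + 1) ω))
    simp only [this, integral_zero]

end Chain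

/-! ### Ergodic averages and consistency of the estimates -/

/-- Shifting the summation index does not affect the limit of averages of a bounded sequence. -/
lemma tendsto_average_shift_sub {x : ℕ → ℝ} {B : ℝ} (hx : ∀ m, |x m| ≤ B) :
    Tendsto (fun M : ℕ => (∑ m ∈ Finset.range M, x m) / M -
      (∑ m ∈ Finset.range M, x (m + 1)) / M) atTop (𝓝 0) := by
  refine squeeze_zero_norm (a := fun M : ℕ => (2 * B) / M) (fun M => ?_)
    (tendsto_const_div_atTop_nhds_zero_nat _)
  have h := Finset.sum_range_succ_sub_sum (f := x) (n := M)
  have h' := Finset.sum_range_succ' x M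
  rw [← sub_div, norm_div, Real.norm_natCast, Real.norm_eq_abs]
  refine div_le_div_of_nonneg_right ?_ (Nat.cast_nonneg M)
  have h1 : ∑ m ∈ Finset.range M, x m - ∑ m ∈ Finset.range M, x (m + 1) = x 0 - x M := by linarith
  rw [h1]
  have := abs_sub (x 0) (x M)
  linarith [hx 0, hx M]

/-- Averages with vanishing differences of the terms have vanishing differences. -/
lemma tendsto_average_sub_of_tendsto_sub {x y : ℕ → ℝ}
    (h : Tendsto (fun m => x m - y m) atTop (𝓝 0)) :
    Tendsto (fun M : ℕ => (∑ m ∈ Finset.range M, x m) / M - (∑ m ∈ Finset.range M, y m) / M)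
      atTop (𝓝 0) := by
  refine h.cesaro.congr fun M => ?_
  rw [Finset.sum_sub_distrib]
  ring

section Ergodic

variable {ι Ω 𝒵 : Type*} [Fintype ι] [DecidableEq ι] [MeasurableSpace Ω] [MeasurableSpace 𝒵]
  {μ : Measure Ω} [IsProbabilityMeasure μ] {pGG pBB : ι → ℝ} {S : ι → ℕ → Ω → Bool} {Z : Ω → 𝒵}

/-- The ergodic theorem for the joint chain. -/
theorem exists_ergodic_average (hZ : Measurable Z)
    (hGG : ∀ i, 0 < pGG i ∧ pGG i < 1) (hBB : ∀ i, 0 < pBB i ∧ pBB i < 1)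
    (hS : ∀ i, IsStationaryChain μ (pGG i) (pBB i) (S i))
    (hindep : iIndepFun (fun i ω m => S i m ω) μ)
    (hZS : IndepFun Z (fun (ω : Ω) (i : ι) (m : ℕ) => S i m ω) μ) (f : (ι → Bool) → ℝ) :
    ∃ c, ((∀ s, 0 ≤ f s) → ∀ s, 0 < f s → 0 < c) ∧
      ∀ᵐ ω ∂μ, Tendsto (fun M : ℕ => (∑ m ∈ Finset.range M, f (state S m ω)) / M) atTop (𝓝 c) := by
  have hpos := outcomeWeight_goodProb_pos (pGG := pGG) (pBB := pBB) hGG hBB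
  have hsum : ∀ s, ∑ t, outcomeWeight (goodProb pGG pBB s) t = 1 := fun s => sum_outcomeWeight _
  obtain ⟨c, g, hg⟩ := exists_poisson_solution hpos hsum f
  refine ⟨c, fun hf s hs => poisson_const_pos hpos hsum hg hf hs, ?_⟩
  obtain ⟨B, hB⟩ : ∃ B, ∀ s, |g s| ≤ B := by
    obtain ⟨s, hs⟩ := Finite.exists_max fun s => |g s|
    exact ⟨_, hs⟩
  filter_upwards [ae_tendsto_average_sub_average hZ hGG hBB hS hindep hZS (B := B)
    (G := fun _ _ _ s => g s) (fun _ _ _ => measurable_const) fun _ _ _ s => hB s] with ω hω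
  -- By the Poisson equation, `f(S_m) - c` is a telescoping term `g(S_m) - g(S_{m+1})` plus the
  -- martingale difference `g(S_{m+1}) - Pg(S_m)`.
  have h1 := tendsto_average_shift_sub (x := fun m => g (state S m ω)) fun m => hB _
  have h2 := (h1.add hω).const_add c
  rw [add_zero, add_zero] at h2
  refine h2.congr' ?_
  filter_upwards [eventually_gt_atTop 0] with M hM
  have hM' : (M : ℝ) ≠ 0 := by positivity
  simp only [hg, Finset.sum_sub_distrib, Finset.sum_add_distrib, Finset.sum_const,
    Finset.card_range, nsmul_eq_mul]
  field_simp
  ring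

/-- The empirical transition frequencies converge to the transition probabilities. -/
theorem ae_tendsto_transition_ratio (hZ : Measurable Z)
    (hGG : ∀ i, 0 < pGG i ∧ pGG i < 1) (hBB : ∀ i, 0 < pBB i ∧ pBB i < 1)
    (hS : ∀ i, IsStationaryChain μ (pGG i) (pBB i) (S i))
    (hindep : iIndepFun (fun i ω m => S i m ω) μ)
    (hZS : IndepFun Z (fun (ω : Ω) (i : ι) (m : ℕ) => S i m ω) μ) (i : ι) (a : Bool) :
    ∀ᵐ ω ∂μ, (∀ᶠ M : ℕ in atTop, 0 < ∑ m ∈ Finset.range M, if S i m ω = a then (1 : ℝ) else 0) ∧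
      Tendsto (fun M : ℕ =>
        (∑ m ∈ Finset.range M, if S i m ω = a ∧ S i (m + 1) ω = true then (1 : ℝ) else 0) /
          ∑ m ∈ Finset.range M, if S i m ω = a then (1 : ℝ) else 0)
        atTop (𝓝 (trans (pGG i) (pBB i) a true)) := by
  obtain ⟨c, hc, hvisit⟩ := exists_ergodic_average hZ hGG hBB hS hindep hZS
    fun s => if s i = a then 1 else 0
  have hc' : 0 < c := hc (fun s => by split_ifs <;> norm_num) (fun _ => a) (by simp)
  filter_upwards [hvisit, ae_tendsto_average_sub_average hZ hGG hBB hS hindep hZS (B := 1)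
    (G := fun m _ h s => if h (Fin.last m) i = a ∧ s i = true then 1 else 0)
    (fun _ _ _ => measurable_const) fun _ _ _ _ => by split_ifs <;> norm_num] with ω h1 h2
  have hev : ∀ᶠ M : ℕ in atTop,
      0 < ∑ m ∈ Finset.range M, if S i m ω = a then (1 : ℝ) else 0 := by
    filter_upwards [h1.eventually (lt_mem_nhds hc'), eventually_gt_atTop 0] with M hM hM0
    exact (div_pos_iff_of_pos_right (by positivity)).1 hM
  refine ⟨hev, ?_⟩
  -- The transitions into the good state minus the transition probability times the visits to `a`
  -- are `o(M)`, while the visits grow like `cM` with `c > 0`.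
  have h3 := (h2.div h1 hc'.ne').add_const (trans (pGG i) (pBB i) a true)
  rw [zero_div, zero_add] at h3
  refine h3.congr' ?_
  filter_upwards [hev, eventually_gt_atTop 0] with M hM hM0
  have hM' : (M : ℝ) ≠ 0 := by positivity
  have hterm : ∀ m, (∑ s, outcomeWeight (goodProb pGG pBB (state S m ω)) s *
      if history S (m + 1) ω (Fin.last m) i = a ∧ s i = true then (1 : ℝ) else 0) =
      trans (pGG i) (pBB i) a true * if S i m ω = a then 1 else 0 := fun m => by
    have hh : history S (m + 1) ω (Fin.last m) i = S i m ω := rfl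
    rw [hh]
    by_cases ha : S i m ω = a
    · simp only [ha, true_and, if_true, mul_one]
      rw [sum_outcomeWeight_mul_ite, goodProb, state, ha]
    · simp [ha]
  simp only [hterm, Finset.sum_sub_distrib, ← Finset.mul_sum]
  rw [Pi.div_apply, div_div_div_cancel_right₀ hM']
  have key : ∀ N T q : ℝ, N ≠ 0 → (T - q * N) / N + q = T / N := fun N T q hN => by
    rw [sub_div, mul_div_cancel_right₀ _ hN, sub_add_cancel]
  exact key _ _ _ hM.ne'

end Ergodic

/-! ### Consistency of the estimates computed by LEA. -/

section Estimate

variable {C : CloudSystem} {Ω : Type*} {S : Fin C.n → ℕ → Ω → Bool}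

lemma transCount_history (M : ℕ) (ω : Ω) (i : Fin C.n) (a b : Bool) :
    (transCount (history S (M + 1) ω) i a b : ℝ) =
      ∑ m ∈ Finset.range M, if S i m ω = a ∧ S i (m + 1) ω = b then 1 else 0 := by
  rw [Finset.sum_boole, transCount]
  congr 1
  refine Finset.card_bij' (fun t _ => t.1.val)
    (fun m hm => (⟨m, by have := (Finset.mem_filter.1 hm).1; simp at this; omega⟩,
      ⟨m + 1, by have := (Finset.mem_filter.1 hm).1; simp at this; omega⟩)) ?_ ?_ ?_ ?_
  · rintro ⟨t, u⟩ ht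
    rw [Finset.mem_filter] at ht
    simp only [Finset.mem_univ, true_and, history] at ht
    simp only [Finset.mem_filter, Finset.mem_range]
    have := u.2
    refine ⟨by omega, ht.2.1, ?_⟩
    rw [ht.1]
    exact ht.2.2
  · intro m hm
    simp only [Finset.mem_filter, Finset.mem_range] at hm
    rw [Finset.mem_filter]
    simpa [history] using hm.2
  · rintro ⟨t, u⟩ ht
    simp only [Finset.mem_filter, Finset.mem_univ, true_and] at ht
    ext <;> simp [ht.1]
  · intro m _
    rfl

lemma transCount_add_transCount (M : ℕ) (ω : Ω) (i : Fin C.n) (a : Bool) :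
    (transCount (history S (M + 1) ω) i a true : ℝ) + transCount (history S (M + 1) ω) i a false =
      ∑ m ∈ Finset.range M, if S i m ω = a then 1 else 0 := by
  rw [transCount_history, transCount_history, ← Finset.sum_add_distrib]
  refine Finset.sum_congr rfl fun m _ => ?_
  by_cases h1 : S i m ω = a <;> cases h2 : S i (m + 1) ω <;> simp [h1]

/-- Both branches of the estimate are the fraction of transitions into the good state among those
leaving the last state: in the bad state, one minus the fraction of returns to it. -/
lemma IsEstimate.eq_ratio {M : ℕ} {ω : Ω} {i : Fin C.n} {p : ℝ}
    (hp : IsEstimate (history S (M + 1) ω) i p)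
    (hpos : 0 < ∑ m ∈ Finset.range M, if S i m ω = S i M ω then (1 : ℝ) else 0) :
    p = (∑ m ∈ Finset.range M,
        if S i m ω = S i M ω ∧ S i (m + 1) ω = true then (1 : ℝ) else 0) /
      ∑ m ∈ Finset.range M, if S i m ω = S i M ω then (1 : ℝ) else 0 := by
  have h := hp.2.2 (Fin.last M) rfl
  have hlast : history S (M + 1) ω (Fin.last M) i = S i M ω := rfl
  rw [hlast] at h
  rw [← transCount_add_transCount] at hpos ⊢
  rw [← transCount_history]
  cases hs : S i M ω
  · rw [hs] at hpos
    rw [h.2 hs (by exact_mod_cast hpos), eq_div_iff hpos.ne', sub_mul, div_mul_cancel₀ _ hpos.ne']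
    ring
  · rw [hs] at hpos
    exact h.1 hs (by exact_mod_cast hpos)

variable {𝒵 : Type*} [MeasurableSpace Ω] [MeasurableSpace 𝒵]
  {μ : Measure Ω} [IsProbabilityMeasure μ] {pGG pBB : Fin C.n → ℝ} {Z : Ω → 𝒵}

/-- Consistency of the estimates of LEA. -/
theorem ae_eventually_abs_estimate_sub_lt (hZ : Measurable Z)
    (hGG : ∀ i, 0 < pGG i ∧ pGG i < 1) (hBB : ∀ i, 0 < pBB i ∧ pBB i < 1)
    (hS : ∀ i, IsStationaryChain μ (pGG i) (pBB i) (S i))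
    (hindep : iIndepFun (fun i ω m => S i m ω) μ)
    (hZS : IndepFun Z (fun (ω : Ω) (i : Fin C.n) (m : ℕ) => S i m ω) μ) :
    ∀ᵐ ω ∂μ, ∀ δ > 0, ∀ᶠ M : ℕ in atTop, ∀ i p, IsEstimate (history S (M + 1) ω) i p →
      |p - goodProb pGG pBB (state S M ω) i| < δ := by
  have hae := ae_all_iff.2 fun i => ae_all_iff.2 fun a =>
    ae_tendsto_transition_ratio hZ hGG hBB hS hindep hZS i a
  filter_upwards [hae] with ω hω δ hδ
  refine eventually_all.2 fun i => ?_
  -- The last state keeps changing, so the estimates themselves need not converge; both values `a`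
  -- are treated separately and each is compared with its own limit.
  have hev : ∀ a, ∀ᶠ M : ℕ in atTop, S i M ω = a → ∀ p, IsEstimate (history S (M + 1) ω) i p →
      |p - goodProb pGG pBB (state S M ω) i| < δ := by
    intro a
    filter_upwards [(hω i a).1, Metric.tendsto_nhds.1 (hω i a).2 δ hδ] with M hpos hM ha p hp
    rw [goodProb, show state S M ω i = a from ha]
    subst ha
    rw [hp.eq_ratio hpos]
    exact hM
  filter_upwards [eventually_all.2 hev] with M hM p hp
  exact hM _ rfl p hp

end Estimate

/-! ### Throughput of strategies -/

section Optimality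

variable {F V W : Type*} [Field F] [AddCommGroup V] [Module F V] [FiniteDimensional F V]
  [AddCommGroup W] [Module F W] {C : CloudSystem}
  {Ω 𝒵 : Type*} [MeasurableSpace 𝒵] {pGG pBB : Fin C.n → ℝ}
  {S : Fin C.n → ℕ → Ω → Bool} {Z : Ω → 𝒵}

lemma Strategy.abs_success_le (η : Strategy C F 𝒵) (m : ℕ) (ω : Ω) :
    |η.success V W Z S m ω| ≤ 1 := by
  unfold Strategy.success
  split_ifs <;> norm_num

/-- The conditional probability, given the history, that round `m + 1` is finished in time. -/
noncomputable def Strategy.condSuccess (V W : Type*) [AddCommGroup V] [Module F V]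
    [FiniteDimensional F V] [AddCommGroup W] [Module F W] (η : Strategy C F 𝒵)
    (pGG pBB : Fin C.n → ℝ) (Z : Ω → 𝒵) (S : Fin C.n → ℕ → Ω → Bool) (m : ℕ) (ω : Ω) : ℝ :=
  ∑ s, outcomeWeight (goodProb pGG pBB (state S m ω)) s *
    if recoveryThreshold V W C.deg η.code ≤
      C.received (η.load (m + 1) (Z ω) (history S (m + 1) ω)) s then 1 else 0

lemma Strategy.condSuccess_le_bestProb [Nontrivial W] (hD : C.deg ≤ Module.finrank F V)
    (hGG : ∀ i, 0 < pGG i ∧ pGG i < 1) (hBB : ∀ i, 0 < pBB i ∧ pBB i < 1)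
    (η : Strategy C F 𝒵) (m : ℕ) (ω : Ω) :
    η.condSuccess V W pGG pBB Z S m ω ≤ C.bestProb (goodProb pGG pBB (state S m ω)) := by
  have hq : ∀ i, 0 ≤ goodProb pGG pBB (state S m ω) i ∧ goodProb pGG pBB (state S m ω) i ≤ 1 :=
    fun i => ⟨(goodProb_mem hGG hBB _ i).1.le, (goodProb_mem hGG hBB _ i).2.le⟩
  refine le_trans ?_ (CloudSystem.succProb_le_bestProb hq _
    (η.load_le (m + 1) (Z ω) (history S (m + 1) ω)))
  refine Finset.sum_le_sum fun s _ => mul_le_mul_of_nonneg_left ?_ (outcomeWeight_nonneg hq s)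
  have := kStar_le_recoveryThreshold (W := W) C hD η.code
  split_ifs <;> first | omega | norm_num

variable [MeasurableSpace Ω] {μ : Measure Ω} [IsProbabilityMeasure μ]

/-- The success frequency is asymptotic to the average of the conditional probabilities. -/
lemma Strategy.ae_tendsto_average_sub (η : Strategy C F 𝒵) (hZ : Measurable Z)
    (hGG : ∀ i, 0 < pGG i ∧ pGG i < 1) (hBB : ∀ i, 0 < pBB i ∧ pBB i < 1)
    (hS : ∀ i, IsStationaryChain μ (pGG i) (pBB i) (S i))
    (hindep : iIndepFun (fun i ω m => S i m ω) μ)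
    (hZS : IndepFun Z (fun (ω : Ω) (i : Fin C.n) (m : ℕ) => S i m ω) μ) :
    ∀ᵐ ω ∂μ, Tendsto (fun M : ℕ => η.average V W Z S M ω -
      (∑ m ∈ Finset.range M, η.condSuccess V W pGG pBB Z S m ω) / M) atTop (𝓝 0) := by
  filter_upwards [ae_tendsto_average_sub_average hZ hGG hBB hS hindep hZS (B := 1)
    (G := fun m z h s => if recoveryThreshold V W C.deg η.code ≤
      C.received (η.load (m + 1) z h) s then 1 else 0)
    (fun m h s => (measurable_of_countable fun ℓ : Fin C.n → ℕ =>
      if recoveryThreshold V W C.deg η.code ≤ C.received ℓ s then (1 : ℝ) else 0).comp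
        (η.measurable_load (m + 1) h))
    fun _ _ _ _ => by split_ifs <;> norm_num] with ω hω
  -- `condSuccess m` concerns round `m + 1`, so the successes are shifted by one round.
  have h1 := tendsto_average_shift_sub (x := fun m => η.success V W Z S m ω)
    fun m => η.abs_success_le m ω
  have h2 := h1.add hω
  rw [add_zero] at h2
  refine h2.congr fun M => ?_
  rw [Finset.sum_sub_distrib, sub_div]
  exact sub_add_sub_cancel _ _ _

/-- The conditional success probabilities of LEA become optimal. -/
lemma Strategy.IsLEA.ae_tendsto_condSuccess_sub [Nontrivial W]
    (hD : C.deg ≤ Module.finrank F V) (hK : C.n * C.loadB < C.kStar) (hZ : Measurable Z)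
    (hGG : ∀ i, 0 < pGG i ∧ pGG i < 1) (hBB : ∀ i, 0 < pBB i ∧ pBB i < 1)
    (hS : ∀ i, IsStationaryChain μ (pGG i) (pBB i) (S i))
    (hindep : iIndepFun (fun i ω m => S i m ω) μ)
    (hZS : IndepFun Z (fun (ω : Ω) (i : Fin C.n) (m : ℕ) => S i m ω) μ)
    {η : Strategy C F 𝒵} (hη : η.IsLEA) :
    ∀ᵐ ω ∂μ, Tendsto (fun m => η.condSuccess V W pGG pBB Z S m ω -
      C.bestProb (goodProb pGG pBB (state S m ω))) atTop (𝓝 0) := by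
  filter_upwards [ae_eventually_abs_estimate_sub_lt hZ hGG hBB hS hindep hZS] with ω hω
  rw [Metric.tendsto_nhds]
  intro ε hε
  have hcont : ∀ s : Fin C.n → Bool, ∃ δ > 0, ∀ p : Fin C.n → ℝ,
      (∀ i, |p i - goodProb pGG pBB s i| < δ) → ∀ A, |C.succProb p (C.loadOn A) -
        C.succProb (goodProb pGG pBB s) (C.loadOn A)| < ε / 2 := fun s => by
    have h1 : ∀ᶠ p in 𝓝 (goodProb pGG pBB s), ∀ A, |C.succProb p (C.loadOn A) -
        C.succProb (goodProb pGG pBB s) (C.loadOn A)| < ε / 2 := eventually_all.2 fun A =>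
      Metric.tendsto_nhds.1 (CloudSystem.continuous_succProb (C.loadOn A)).continuousAt _
        (half_pos hε)
    obtain ⟨δ, hδ, h2⟩ := Metric.eventually_nhds_iff.1 h1
    exact ⟨δ, hδ, fun p hp => h2 ((dist_pi_lt_iff hδ).2 hp)⟩
  choose δ hδ hsucc using hcont
  -- There are finitely many joint states, so one tolerance serves all of them, whatever the current
  -- state.
  have hmin : 0 < Finset.univ.inf' Finset.univ_nonempty δ :=
    (Finset.lt_inf'_iff _).2 fun s _ => hδ s
  filter_upwards [hω _ hmin] with m hm
  obtain ⟨p, hp, A, hload, hbest⟩ :=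
    CloudSystem.exists_estimate_of_isEALoad hK (hη.2 (m + 1) (Z ω) (history S (m + 1) ω))
  have hclose := hsucc (state S m ω) p fun i => (hm i (p i) (hp i)).trans_le
    (Finset.inf'_le _ (Finset.mem_univ _))
  have hcond : η.condSuccess V W pGG pBB Z S m ω =
      C.succProb (goodProb pGG pBB (state S m ω)) (C.loadOn A) := by
    rw [Strategy.condSuccess, hload, hη.1.recoveryThreshold_eq C hD]
    rfl
  obtain ⟨B, -, hB⟩ := Finset.exists_mem_eq_sup' Finset.univ_nonempty
    fun A => C.succProb (goodProb pGG pBB (state S m ω)) (C.loadOn A)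
  have hB' : C.bestProb (goodProb pGG pBB (state S m ω)) =
      C.succProb (goodProb pGG pBB (state S m ω)) (C.loadOn B) := hB
  have h1 := abs_lt.1 (hclose A)
  have h2 := abs_lt.1 (hclose B)
  have h3 := hbest B
  have h4 := CloudSystem.succProb_loadOn_le_bestProb (goodProb pGG pBB (state S m ω)) A
  -- `A` is optimal for the estimates and `B` for the true probabilities; passing from true to
  -- estimated values at `B` and back at `A` costs `ε / 2` each.
  rw [Real.dist_eq, sub_zero, hcond, abs_lt]
  constructor <;> linarith

end Optimality

end CodedComputing

theorem theorem2
    {F V W : Type*} [Field F] [AddCommGroup V] [Module F V] [FiniteDimensional F V]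
    [AddCommGroup W] [Module F W] [Nontrivial W]
    (C : CodedComputing.CloudSystem)
    (hdim : C.deg ≤ Module.finrank F V)
    (hK : C.n * C.loadB < C.kStar)
    {Ω 𝒵 : Type*} [MeasurableSpace Ω] [MeasurableSpace 𝒵]
    (μ : MeasureTheory.Measure Ω) [MeasureTheory.IsProbabilityMeasure μ]
    (pGG pBB : Fin C.n → ℝ)
    (hGG : ∀ i, 0 < pGG i ∧ pGG i < 1) (hBB : ∀ i, 0 < pBB i ∧ pBB i < 1)
    (S : Fin C.n → ℕ → Ω → Bool)
    (hS : ∀ i, CodedComputing.IsStationaryChain μ (pGG i) (pBB i) (S i))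
    (hindep : ProbabilityTheory.iIndepFun (fun (i : Fin C.n) (ω : Ω) (m : ℕ) => S i m ω) μ)
    (Z : Ω → 𝒵) (hZ : Measurable Z)
    (hZS : ProbabilityTheory.IndepFun Z (fun (ω : Ω) (i : Fin C.n) (m : ℕ) => S i m ω) μ)
    (lea : CodedComputing.Strategy C F 𝒵) (hlea : lea.IsLEA) :
    lea.HasThroughput V W μ Z S (CodedComputing.optThroughput C F V W μ Z S) ∧
    ∀ η : CodedComputing.Strategy C F 𝒵, ∀ᵐ ω ∂μ,
      Filter.limsup (fun M => η.average V W Z S M ω) Filter.atTop ≤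
        CodedComputing.optThroughput C F V W μ Z S := by
  open CodedComputing in
  -- The constant `c` does not depend on any strategy; it turns out to be `R*`.
  obtain ⟨c, -, hc⟩ := exists_ergodic_average hZ hGG hBB hS hindep hZS
    fun s => C.bestProb (goodProb pGG pBB s)
  have hupper : ∀ η : Strategy C F 𝒵, ∀ᵐ ω ∂μ,
      limsup (fun M => η.average V W Z S M ω) atTop ≤ c := fun η => by
    filter_upwards [hc, η.ae_tendsto_average_sub (V := V) (W := W) hZ hGG hBB hS hindep hZS]
      with ω h1 h2
    have h3 := h2.add h1
    rw [zero_add] at h3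
    rw [← h3.limsup_eq]
    refine limsup_le_limsup (Eventually.of_forall fun M => ?_) ?_ h3.isBoundedUnder_le
    · have h4 : (∑ m ∈ Finset.range M, η.condSuccess V W pGG pBB Z S m ω) / (M : ℝ) ≤
          (∑ m ∈ Finset.range M, C.bestProb (goodProb pGG pBB (state S m ω))) / M :=
        div_le_div_of_nonneg_right (Finset.sum_le_sum fun m _ =>
          η.condSuccess_le_bestProb hdim hGG hBB m ω) (Nat.cast_nonneg M)
      simp only
      linarith
    -- Real limsups are monotone only under boundedness; here the averages are bounded below by `0`.
    · refine IsBoundedUnder.isCoboundedUnder_le ⟨0, ?_⟩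
      refine eventually_map.2 (Eventually.of_forall fun M => ?_)
      refine div_nonneg (Finset.sum_nonneg fun m _ => ?_) (Nat.cast_nonneg M)
      unfold Strategy.success
      split_ifs <;> norm_num
  have hthroughput : lea.HasThroughput V W μ Z S c := by
    filter_upwards [hc, lea.ae_tendsto_average_sub (V := V) (W := W) hZ hGG hBB hS hindep hZS,
      hlea.ae_tendsto_condSuccess_sub (V := V) (W := W) hdim hK hZ hGG hBB hS hindep hZS]
      with ω h1 h2 h3
    have h4 := (h2.add (tendsto_average_sub_of_tendsto_sub h3)).add h1
    rw [add_zero, zero_add] at h4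
    exact h4.congr fun M => by ring
  have hopt : optThroughput C F V W μ Z S = c := by
    -- LEA itself attains the supremum. For the upper bound, two almost sure events have a common
    -- point, where the limsup is the throughput.
    refine IsGreatest.csSup_eq ⟨⟨lea, hthroughput⟩, ?_⟩
    rintro ρ ⟨η, hη⟩
    obtain ⟨ω, h1, h2⟩ := (hη.and (hupper η)).exists
    rwa [h1.limsup_eq] at h2
  rw [hopt]
  exact ⟨hthroughput, hupper⟩
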